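/- Let $q=p^a$ be a prime power, let $r\ge 1$, and let $\mathbb F_q\subset\mathbb F_{q^r}$ be finite fields with $q$ and $q^r$ elements. Let $D$ be an étale $\varphi$-module over $\mathbb F_{q^r}$, that is, a finite-dimensional $\mathbb F_{q^r}$-vector space with an additive map $\varphi:D\to D$ such that $\varphi(cx)=c^q\varphi(x)$ for $c\in\mathbb F_{q^r}$, $x\in D$, and such that $\varphi(D)$ spans $D$. Let $V=\operatorname{Hom}_\varphi(D,\mathbb F_{q^r}^{\mathrm{sep}})$ be the associated representation: the $\mathbb F_q$-vector space of all $\mathbb F_{q^r}$-linear maps $f:D\to\mathbb F_{q^r}^{\mathrm{sep}}$ with $f(\varphi(x))=f(x)^q$ for all $x$, on which $\operatorname{Gal}(\mathbb F_{q^r}^{\mathrm{sep}}/\mathbb F_{q^r})$ acts by $\gamma\cdot f=\gamma\circ f$. Let $g$ be the $\mathbb F_q$-linear endomorphism of $V$ given by the action of the Frobenius element $z\mapsto z^{q^r}$. A Jordan block of length $t\ge 1$ is a block matrix $$\begin{pmatrix} A & I & & \\ & A & \ddots & \\ & & \ddots & I\\ & & & A\end{pmatrix}$$ with $t$ diagonal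 blocks $A$, where $A$ is a square matrix over $\mathbb F_q$ with irreducible characteristic polynomial; a Jordan form of $g$ is a block-diagonal matrix of $g$, in some basis of $V$, whose diagonal blocks are Jordan blocks. Assume that all the composition factors of the $\varphi$-module $D$ (the simple successive quotients of a composition series of $D$ by $\varphi$-stable subspaces) are isomorphic as $\varphi$-modules. Then $g$ has a Jordan form, and for the number $m$ of Jordan blocks in any Jordan form of $g$, one has: $D$ has a generator (there is an $x\in D$ such that $x,\varphi(x),\varphi^2(x),\dots$ span $D$ over $\mathbb F_{q^r}$) if and only if $m\le r$. -/

import Mathlib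

namespace PhiMod

section SemilinearAlgebra

variable {K : Type*} [Field K] {σ : K →+* K}
variable {D : Type*} [AddCommGroup D] [Module K D]
variable {D' : Type*} [AddCommGroup D'] [Module K D']

/-- A `φ`-module `(D, φ)` is étale if the image of `φ` contains a basis of `D`,
i.e. spans `D`. -/
def IsEtale (φ : D →ₛₗ[σ] D) : Prop :=
  Submodule.span K (Set.range φ) = ⊤

/-- The vector `x` generates the `φ`-module `D`: the subspace spanned by
`x, φ x, φ² x, …` (the sub-`φ`-module generated by `x`) is `D`. -/
def Generates (φ : D →ₛₗ[σ] D) (x : D) : Prop :=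
  Submodule.span K (Set.range fun i : ℕ => φ^[i] x) = ⊤

/-- The `φ`-module `D` has a generator. -/
def HasGenerator (φ : D →ₛₗ[σ] D) : Prop :=
  ∃ x : D, Generates φ x

/-- `W` is a sub-`φ`-module of `D`: a subspace stable under `φ`. -/
def IsStable (φ : D →ₛₗ[σ] D) (W : Submodule K D) : Prop :=
  ∀ x ∈ W, φ x ∈ W

/-- A `φ`-module is simple if it is nonzero and has no nontrivial sub-`φ`-module. -/
def IsSimple (φ : D →ₛₗ[σ] D) : Prop :=
  Nontrivial D ∧ ∀ W : Submodule K D, IsStable φ W → W = ⊥ ∨ W = ⊤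

/-- Two `φ`-modules are isomorphic: there is a `K`-linear bijection commuting with `φ`. -/
def Isomorphic (φ : D →ₛₗ[σ] D) (φ' : D' →ₛₗ[σ] D') : Prop :=
  ∃ e : D ≃ₗ[K] D', ∀ x, e (φ x) = φ' (e x)

/-- The map induced by `φ` on a sub-`φ`-module. -/
def subMap (φ : D →ₛₗ[σ] D) (M : Submodule K D) (hM : IsStable φ M) : M →ₛₗ[σ] M where
  toFun x := ⟨φ x, hM x x.2⟩
  map_add' x y := Subtype.ext (by simp)
  map_smul' c x := Subtype.ext (by simp)

/-- The map induced by `φ` on the subquotient `M / N` of `D`, where `M` and `N` are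
sub-`φ`-modules. -/
def subquotientMap (φ : D →ₛₗ[σ] D) (N M : Submodule K D)
    (hN : IsStable φ N) (hM : IsStable φ M) :
    (M ⧸ N.submoduleOf M) →ₛₗ[σ] (M ⧸ N.submoduleOf M) :=
  Submodule.mapQ (N.submoduleOf M) (N.submoduleOf M) (subMap φ M hM)
    (fun x hx => hN x hx)

/-- A composition series `0 = D₀ ⊂ D₁ ⊂ … ⊂ Dₘ = D` of the `φ`-module `D`: a chain of
sub-`φ`-modules whose successive quotients are simple `φ`-modules. -/
structure CompSeries (φ : D →ₛₗ[σ] D) where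
  /-- The number of steps. -/
  length : ℕ
  /-- The terms of the series. -/
  term : Fin (length + 1) → Submodule K D
  stable : ∀ i, IsStable φ (term i)
  mono : ∀ i : Fin length, term i.castSucc ≤ term i.succ
  bot : term 0 = ⊥
  top : term (Fin.last length) = ⊤
  simple : ∀ i : Fin length,
    IsSimple (subquotientMap φ (term i.castSucc) (term i.succ) (stable _) (stable _))

/-- The induced map on the `i`-th composition factor of a composition series. -/
def CompSeries.factorMap {φ : D →ₛₗ[σ] D} (s : CompSeries φ) (i : Fin s.length) :
    (s.term i.succ ⧸ (s.term i.castSucc).submoduleOf (s.term i.succ)) →ₛₗ[σ]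
      (s.term i.succ ⧸ (s.term i.castSucc).submoduleOf (s.term i.succ)) :=
  subquotientMap φ (s.term i.castSucc) (s.term i.succ) (s.stable _) (s.stable _)

/-- All composition factors of `D` are isomorphic. By the Jordan-Hölder theorem the
composition factors do not depend on the composition series, so this is the condition that
the factors of some composition series are pairwise isomorphic. -/
def CompositionFactorsIsomorphic (φ : D →ₛₗ[σ] D) : Prop :=
  ∃ s : CompSeries φ, ∀ i j : Fin s.length, Isomorphic (s.factorMap i) (s.factorMap j)

end SemilinearAlgebra

section Jordan

variable {F : Type*} [Field F]

/-- The Jordan block of length `t` attached to a square matrix `A`: the block matrix with `t`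
diagonal blocks equal to `A`, with identity blocks just above the diagonal, and with zero
blocks elsewhere. -/
def jordanBlock {n : ℕ} (A : Matrix (Fin n) (Fin n) F) (t : ℕ) :
    Matrix (Fin t × Fin n) (Fin t × Fin n) F :=
  Matrix.of fun x y =>
    if x.1 = y.1 then A x.2 y.2
    else if (x.1 : ℕ) + 1 = y.1 then (1 : Matrix (Fin n) (Fin n) F) x.2 y.2
    else 0

/-- The endomorphism `g` has a Jordan form with `m` Jordan blocks: in some basis its matrix is
block-diagonal with `m` diagonal blocks, each of which is a Jordan block of positive length
attached to a matrix with irreducible characteristic polynomial. -/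
def HasJordanFormWithBlocks {V : Type*} [AddCommMonoid V] [Module F V]
    (g : V →ₗ[F] V) (m : ℕ) : Prop :=
  ∃ (n t : Fin m → ℕ) (A : ∀ i, Matrix (Fin (n i)) (Fin (n i)) F)
    (b : Module.Basis (Σ i : Fin m, Fin (t i) × Fin (n i)) F V),
    (∀ i, 0 < t i) ∧ (∀ i, Irreducible (A i).charpoly) ∧
      ∀ x y, b.repr (g (b y)) x = Matrix.blockDiagonal' (fun i => jordanBlock (A i) (t i)) x y

end Jordan

noncomputable section Galois

variable (F K : Type*) [Field F] [Fintype F] [Field K] [Algebra F K]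

/-- The endomorphism `x ↦ x ^ q` of `K`, where `q` is the number of elements of `F`. -/
abbrev frob : K →+* K :=
  (FiniteField.frobeniusAlgHom F K).toRingHom

variable {K} {D : Type*} [AddCommGroup D] [Module K D]

/-- The `F`-vector space `V = Hom_φ(D, Kˢᵉᵖ)` of `K`-linear maps `f : D → Kˢᵉᵖ` such that
`f (φ x) = (f x) ^ q` for all `x`. -/
def assocSpace (φ : D →ₛₗ[frob F K] D) : Submodule F (D →ₗ[K] SeparableClosure K) where
  carrier := {f | ∀ x, f (φ x) = f x ^ Fintype.card F}
  zero_mem' x := by simp [Fintype.card_ne_zero]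
  add_mem' {f g} hf hg x := by
    have h := map_add (FiniteField.frobeniusAlgHom F (SeparableClosure K)) (f x) (g x)
    simp only [FiniteField.coe_frobeniusAlgHom] at h
    simp only [LinearMap.add_apply, hf x, hg x, h]
  smul_mem' c f hf x := by
    simp only [LinearMap.smul_apply, hf x, smul_pow, FiniteField.pow_card]

/-- The `F`-linear representation of `G_K = Gal(Kˢᵉᵖ/K)` associated to the `φ`-module `D`: an
element `γ` maps `f` to `γ ∘ f`. -/
def assocRep (φ : D →ₛₗ[frob F K] D) :
    Representation F (SeparableClosure K ≃ₐ[K] SeparableClosure K) (assocSpace F φ) where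
  toFun γ :=
    { toFun := fun f => ⟨γ.toLinearMap ∘ₗ f.1, fun x => by
        have h : f.1 (φ x) = f.1 x ^ Fintype.card F := f.2 x
        exact (congrArg γ h).trans (map_pow γ _ _)⟩
      map_add' := fun f g => Subtype.ext (LinearMap.ext fun x => by simp)
      map_smul' := fun c f => Subtype.ext (LinearMap.ext fun x => by
        exact map_smul (γ.restrictScalars F) c (f.1 x)) }
  map_one' := LinearMap.ext fun f => Subtype.ext (LinearMap.ext fun x => rfl)
  map_mul' γ δ := LinearMap.ext fun f => Subtype.ext (LinearMap.ext fun x => rfl)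

/-- The action on the associated representation of the Frobenius element `z ↦ z ^ #K` of
`Gal(Kˢᵉᵖ/K)`, for `K` finite. -/
def frobeniusOnRep [Fintype K] (φ : D →ₛₗ[frob F K] D) : assocSpace F φ →ₗ[F] assocSpace F φ :=
  assocRep F φ (FiniteField.frobeniusAlgEquivOfAlgebraic K (SeparableClosure K))

end Galois

end PhiMod

/-! ### Divisible modules over a principal ideal ring and embeddings of primary modules -/

section PrincipalIdealDomain

open Submodule

variable {R : Type*} [CommRing R] [IsPrincipalIdealRing R]
variable {M N : Type*} [AddCommGroup M] [Module R M] [AddCommGroup N] [Module R N]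

/-! Write `Ω` for the separable closure of `K` and `Q = #K = q ^ r`. A vector `x` generates `D`
exactly when evaluation at `x` is injective on `V`, and evaluations are precisely the `F`-linear
maps `V → Ω` that turn `g` into `z ↦ z ^ Q`. So `D` has a generator iff the `F[X]`-module `V` (with
`X` acting as `g`) embeds into `Ω` (with `X` acting as the `Q`-power map); this is
`hasGenerator_iff`. It rests on a duality: `F`-independent elements of `V` stay `Ω`-independent, and
`V` spans `Hom_K(D, Ω)`.

On `Ω` a polynomial `P` acts through the linearized polynomial `∑ aᵢ z ^ (Q ^ i)`. Hence `Ω` is a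
divisible, so injective, `F[X]`-module, and the kernel of `P` has `Q ^ deg P` elements when `P(0) ≠
0`.

Since `φ ^ r` is `K`-linear and commutes with `φ`, an irreducible `f` over `F` kills it on one
composition factor, hence on all of them, as they are isomorphic. Thus a power of `f` kills `φ ^ r`
on `D`, and by transposition `g` on `V`. An `f`-primary module embeds into an injective one iff its
`f`-torsion is not larger (`Module.exists_injective_iff_card_torsionBy_le`). Each Jordan block of
`g` contributes `q ^ deg f` to the size of `ker f(g)`, so the criterion reads `m * deg f ≤ r * deg
f`. -/

/-- A divisible module over a principal ideal domain satisfies Baer's criterion. -/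
theorem Module.baer_of_smul_surjective
    (hN : ∀ a : R, a ≠ 0 → Function.Surjective fun y : N => a • y) : Module.Baer R N := by
  intro I g
  obtain ⟨a, rfl⟩ := IsPrincipalIdealRing.principal I
  by_cases ha : a = 0
  · refine ⟨0, fun x hx => ?_⟩
    have hx0 : x = 0 := by simpa [ha] using hx
    subst hx0
    exact (map_zero g).symm
  · obtain ⟨y, hy⟩ := hN a ha (g ⟨a, mem_span_singleton_self a⟩)
    refine ⟨LinearMap.toSpanSingleton R N y, fun x hx => ?_⟩
    obtain ⟨b, rfl⟩ := mem_span_singleton.1 hx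
    have h : (⟨b • a, hx⟩ : ↥(span R {a})) = b • ⟨a, mem_span_singleton_self a⟩ := rfl
    rw [h, LinearMap.map_smul g, ← hy]
    exact mul_smul b a y

/-- An `f`-primary module `M` embeds into a divisible module `N` if and only if the `f`-torsion of
`M` is at most as large as the `f`-torsion of `N`. -/
theorem Module.exists_injective_iff_card_torsionBy_le [IsDomain R]
    (hN : ∀ a : R, a ≠ 0 → Function.Surjective fun y : N => a • y)
    {f : R} (hf : Irreducible f) [Finite (R ⧸ span R {f})]
    [Finite (torsionBy R M f)] [Finite (torsionBy R N f)]
    {s : ℕ} (hM : ∀ x : M, f ^ s • x = 0) :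
    (∃ h : M →ₗ[R] N, Function.Injective h) ↔
      Nat.card (torsionBy R M f) ≤ Nat.card (torsionBy R N f) := by
  constructor
  · rintro ⟨h, hh⟩
    refine Nat.card_le_card_of_injective
      (fun x : torsionBy R M f => (⟨h x, ?_⟩ : torsionBy R N f)) ?_
    · have := x.2
      rw [mem_torsionBy_iff] at this ⊢
      rw [← map_smul, this, map_zero]
    · intro x y hxy
      exact Subtype.ext (hh (congrArg Subtype.val hxy))
  · intro hcard
    -- Both torsion modules are vector spaces over the residue field `R / (f)`, so comparing
    -- cardinalities compares dimensions.
    have := PrincipalIdealRing.isMaximal_of_irreducible hf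
    let _ := Ideal.Quotient.field (R ∙ f)
    have hcM := Module.natCard_eq_pow_finrank (K := R ⧸ R ∙ f) (V := torsionBy R M f)
    have hcN := Module.natCard_eq_pow_finrank (K := R ⧸ R ∙ f) (V := torsionBy R N f)
    rw [hcM, hcN, Nat.pow_le_pow_iff_right Finite.one_lt_card] at hcard
    obtain ⟨j, hj⟩ : ∃ j : torsionBy R M f →ₗ[R ⧸ R ∙ f] torsionBy R N f,
        Function.Injective j := finrank_le_iff_exists_linearMap.1 hcard
    obtain ⟨h, hh⟩ := (Module.baer_of_smul_surjective hN).extension_property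
      (torsionBy R M f).subtype (injective_subtype _)
      ((torsionBy R N f).subtype ∘ₗ j.restrictScalars R)
    refine ⟨h, (injective_iff_map_eq_zero h).2 ?_⟩
    -- The extension `h` is injective because a nonzero kernel element would have a nonzero multiple
    -- `f ^ n • x` in the torsion, where `h` agrees with the injective `j`.
    have key : ∀ n : ℕ, ∀ x : M, f ^ n • x = 0 → h x = 0 → x = 0 := by
      intro n
      induction n with
      | zero => intro x hx _; simpa using hx
      | succ n ih =>
        intro x hx hx0
        have hmem : f ^ n • x ∈ torsionBy R M f := by
          rw [mem_torsionBy_iff, smul_smul, ← pow_succ', hx]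
        have h1 := LinearMap.congr_fun hh ⟨f ^ n • x, hmem⟩
        simp only [LinearMap.comp_apply, subtype_apply, map_smul, hx0, smul_zero,
          LinearMap.coe_restrictScalars] at h1
        have h2 : j ⟨f ^ n • x, hmem⟩ = 0 := Subtype.ext h1.symm
        have h3 : (⟨f ^ n • x, hmem⟩ : torsionBy R M f) = 0 := hj (h2.trans (map_zero j).symm)
        exact ih x (congrArg Subtype.val h3) hx0
    exact fun x hx => key s x (hM x) hx

end PrincipalIdealDomain

/-! ### Endomorphisms as `F[X]`-modules -/

section AEval

open Polynomial

variable {F V : Type*} [Field F] [AddCommGroup V] [Module F V]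

/-- The `p`-torsion of the `F[X]`-module attached to `g` is the kernel of `p(g)`. -/
def Module.AEval'.torsionByEquiv (g : V →ₗ[F] V) (p : F[X]) :
    Submodule.torsionBy F[X] (Module.AEval' g) p ≃ LinearMap.ker (aeval g p) :=
  Equiv.subtypeEquiv (Module.AEval'.of g).symm.toEquiv fun x => by
    obtain ⟨x, rfl⟩ := (Module.AEval'.of g).surjective x
    rw [Submodule.mem_torsionBy_iff, ← Module.AEval.of_aeval_smul]
    simp

theorem LinearMap.apply_aeval_of_comm {W : Type*} [AddCommGroup W] [Module F W]
    {g : V →ₗ[F] V} {g' : W →ₗ[F] W} (h : V →ₗ[F] W) (hh : ∀ v, h (g v) = g' (h v))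
    (p : F[X]) (v : V) : h (aeval g p v) = aeval g' p (h v) := by
  induction p using Polynomial.induction_on' generalizing v with
  | add p q hp hq => simp [hp, hq]
  | monomial n a =>
    have : ∀ v, h ((g ^ n) v) = (g' ^ n) (h v) := by
      induction n with
      | zero => simp
      | succ n ih => intro v; rw [pow_succ', pow_succ']; simp [hh, ih]
    simp [aeval_monomial, Module.algebraMap_end_apply, this]

/-- A linear map intertwining `g` and `g'` is linear for the `F[X]`-module structures. -/
def Module.AEval'.mapOfComm {W : Type*} [AddCommGroup W] [Module F W]
    {g : V →ₗ[F] V} {g' : W →ₗ[F] W} (h : V →ₗ[F] W) (hh : ∀ v, h (g v) = g' (h v)) :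
    Module.AEval' g →ₗ[F[X]] Module.AEval' g' where
  toFun x := Module.AEval'.of g' (h ((Module.AEval'.of g).symm x))
  map_add' x y := by simp
  map_smul' p x := by
    obtain ⟨x, rfl⟩ := (Module.AEval'.of g).surjective x
    rw [← Module.AEval.of_aeval_smul]
    simp only [LinearEquiv.symm_apply_apply, RingHom.id_apply]
    rw [← Module.AEval.of_aeval_smul]
    simp [LinearMap.apply_aeval_of_comm h hh]

/-- An endomorphism killed by a power of an irreducible polynomial `f` embeds into a divisible
one if and only if its kernel of `f` is not larger. -/
theorem LinearMap.exists_injective_comm_iff_card_ker_le [Finite F] {W : Type*} [AddCommGroup W]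
    [Module F W] {g : V →ₗ[F] V} {g' : W →ₗ[F] W} [Finite V] {f : F[X]} (hf : Irreducible f)
    {s : ℕ} (hs : aeval g (f ^ s) = 0)
    (hg' : ∀ p : F[X], p ≠ 0 → Function.Surjective (aeval g' p))
    (hfin : Finite (LinearMap.ker (aeval g' f))) :
    (∃ h : V →ₗ[F] W, Function.Injective h ∧ ∀ v, h (g v) = g' (h v)) ↔
      Nat.card (LinearMap.ker (aeval g f)) ≤ Nat.card (LinearMap.ker (aeval g' f)) := by
  have hq : Finite (F[X] ⧸ Submodule.span F[X] {f}) := by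
    have : Module.Finite F (AdjoinRoot f) := (AdjoinRoot.powerBasis hf.ne_zero).finite
    exact (Module.finite_of_finite F : Finite (AdjoinRoot f))
  have hfinM : Finite (Submodule.torsionBy F[X] (Module.AEval' g) f) :=
    Finite.of_equiv _ (Module.AEval'.torsionByEquiv g f).symm
  have hfinN : Finite (Submodule.torsionBy F[X] (Module.AEval' g') f) :=
    Finite.of_equiv _ (Module.AEval'.torsionByEquiv g' f).symm
  have hdiv : ∀ a : F[X], a ≠ 0 → Function.Surjective fun y : Module.AEval' g' => a • y := by
    intro a ha y
    obtain ⟨y, rfl⟩ := (Module.AEval'.of g').surjective y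
    obtain ⟨z, hz⟩ := hg' a ha y
    refine ⟨Module.AEval'.of g' z, ?_⟩
    change a • Module.AEval'.of g' z = _
    rw [← Module.AEval.of_aeval_smul, ← hz]
    rfl
  have hM : ∀ x : Module.AEval' g, f ^ s • x = 0 := by
    intro x
    obtain ⟨x, rfl⟩ := (Module.AEval'.of g).surjective x
    rw [← Module.AEval.of_aeval_smul, hs, zero_smul, map_zero]
  have hcrit := Module.exists_injective_iff_card_torsionBy_le hdiv hf hM
  rw [Nat.card_congr (Module.AEval'.torsionByEquiv g f),
    Nat.card_congr (Module.AEval'.torsionByEquiv g' f)] at hcrit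
  rw [← hcrit]
  constructor
  · rintro ⟨h, hinj, hh⟩
    refine ⟨Module.AEval'.mapOfComm h hh, ?_⟩
    exact (Module.AEval'.of g').injective.comp
      (hinj.comp (Module.AEval'.of g).symm.injective)
  · rintro ⟨h, hinj⟩
    refine ⟨(Module.AEval'.of g').symm.toLinearMap ∘ₗ h.restrictScalars F ∘ₗ
      (Module.AEval'.of g).toLinearMap, ?_, fun u => ?_⟩
    · exact (Module.AEval'.of g').symm.injective.comp
        (hinj.comp (Module.AEval'.of g).injective)
    · simp only [LinearMap.comp_apply, LinearEquiv.coe_coe, LinearMap.coe_restrictScalars]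
      rw [← Module.AEval'.of_symm_X_smul, ← map_smul, Module.AEval'.X_smul_of]

end AEval

/-! ### Linearized polynomials over an algebraically closed field -/

section LinearizedPolynomial

open Polynomial

variable {F Ω : Type*} [Field F] [Field Ω] [Algebra F Ω]

/-- The polynomial `∑ aᵢ X ^ (Q ^ i)` attached to `∑ aᵢ X ^ i`. -/
noncomputable def Polynomial.linearized (Q : ℕ) (P : F[X]) : F[X] :=
  ∑ i ∈ Finset.range (P.natDegree + 1), C (P.coeff i) * X ^ Q ^ i

theorem Polynomial.natDegree_linearized {Q : ℕ} (hQ : 1 < Q) {P : F[X]} (hP : P ≠ 0) :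
    (P.linearized Q).natDegree = Q ^ P.natDegree := by
  rw [linearized, Finset.sum_range_succ, natDegree_add_eq_right_of_degree_lt,
    coeff_natDegree, natDegree_C_mul_X_pow _ _ (leadingCoeff_ne_zero.2 hP)]
  rw [coeff_natDegree, degree_C_mul_X_pow _ (leadingCoeff_ne_zero.2 hP)]
  refine (degree_sum_le _ _).trans_lt ((Finset.sup_lt_iff (WithBot.bot_lt_coe _)).2 ?_)
  intro i hi
  refine (degree_C_mul_X_pow_le _ _).trans_lt ?_
  exact_mod_cast Nat.pow_lt_pow_right hQ (Finset.mem_range.1 hi)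

/-- Every exponent `Q ^ i` with `i > 0` vanishes in `F`. A nonzero constant coefficient of `P`
therefore makes the linearized polynomial separable. -/
theorem Polynomial.derivative_linearized {Q : ℕ} (hQ : (Q : F) = 0) (P : F[X]) :
    derivative (P.linearized Q) = C (P.coeff 0) := by
  rw [linearized, derivative_sum, Finset.sum_eq_single 0]
  · simp
  · intro i _ hi
    have : ((Q ^ i : ℕ) : F) = 0 := by simp [hQ, hi]
    rw [derivative_C_mul_X_pow, this]
    simp
  · simp

theorem Polynomial.aeval_linearized {Q : ℕ} (Φ : Ω →ₗ[F] Ω) (hΦ : ∀ z, Φ z = z ^ Q) (P : F[X])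
    (z : Ω) : aeval z (P.linearized Q) = aeval Φ P z := by
  have hpow : ∀ i : ℕ, (Φ ^ i) z = z ^ Q ^ i := by
    intro i
    induction i with
    | zero => simp
    | succ i ih => rw [pow_succ', Module.End.mul_apply, ih, hΦ, pow_succ, pow_mul]
  rw [linearized, aeval_eq_sum_range (p := P)]
  simp [hpow, Algebra.smul_def]

variable [IsAlgClosed Ω]

/-- A preimage of `c` is a root of the linearized polynomial minus `c`, which is never constant. -/
theorem Polynomial.aeval_frobenius_surjective {Q : ℕ} (hQ : 1 < Q) (Φ : Ω →ₗ[F] Ω)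
    (hΦ : ∀ z, Φ z = z ^ Q) {P : F[X]} (hP : P ≠ 0) : Function.Surjective (aeval Φ P) := by
  intro c
  have hd : ((P.linearized Q).map (algebraMap F Ω) - C c).natDegree ≠ 0 := by
    rw [natDegree_sub_C, natDegree_map, natDegree_linearized hQ hP]
    exact (pow_pos (by omega) _).ne'
  obtain ⟨z, hz⟩ := IsAlgClosed.exists_root _ (fun h => hd (natDegree_eq_of_degree_eq_some h))
  refine ⟨z, ?_⟩
  rw [← aeval_linearized Φ hΦ]
  simpa [IsRoot, sub_eq_zero, eval_map_algebraMap] using hz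

/-- The kernel is the root set of a separable polynomial of degree `Q ^ deg P`. -/
theorem Polynomial.card_ker_aeval_frobenius {Q : ℕ} (hQ : 1 < Q) (hQ0 : (Q : F) = 0)
    (Φ : Ω →ₗ[F] Ω) (hΦ : ∀ z, Φ z = z ^ Q) {P : F[X]} (hP : P.coeff 0 ≠ 0) :
    Nat.card (LinearMap.ker (aeval Φ P)) = Q ^ P.natDegree := by
  have hP0 : P ≠ 0 := by rintro rfl; simp at hP
  have hsep : (P.linearized Q).Separable := by
    rw [separable_def, derivative_linearized hQ0]
    exact ⟨0, C (P.coeff 0)⁻¹, by rw [zero_mul, zero_add, ← C_mul, inv_mul_cancel₀ hP, C_1]⟩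
  have hne : P.linearized Q ≠ 0 := hsep.ne_zero
  rw [← natDegree_linearized hQ hP0, ← card_rootSet_eq_natDegree (K := Ω) hsep
    (IsAlgClosed.splits _), ← Nat.card_eq_fintype_card]
  refine Nat.card_congr (Equiv.subtypeEquivRight fun z => ?_)
  rw [mem_rootSet, aeval_linearized Φ hΦ]
  simp [hne]

end LinearizedPolynomial

namespace PhiMod

/-! ### Powers of Frobenius and their fixed points -/

section FrobeniusPowers

open Polynomial

variable (F : Type*) [Field F] [Fintype F] {Ω : Type*} [Field Ω] [Algebra F Ω]

theorem frobeniusAlgHom_pow_apply (i : ℕ) (z : Ω) :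
    (FiniteField.frobeniusAlgHom F Ω ^ i) z = z ^ Fintype.card F ^ i := by
  rw [AlgHom.coe_pow, FiniteField.coe_frobeniusAlgHom, pow_iterate]

theorem sum_pow_card_pow {ι : Type*} (s : Finset ι) (a : ι → Ω) (i : ℕ) :
    (∑ j ∈ s, a j) ^ Fintype.card F ^ i = ∑ j ∈ s, a j ^ Fintype.card F ^ i := by
  simpa only [frobeniusAlgHom_pow_apply] using map_sum (FiniteField.frobeniusAlgHom F Ω ^ i) a s

theorem sum_pow_card {ι : Type*} (s : Finset ι) (a : ι → Ω) :
    (∑ j ∈ s, a j) ^ Fintype.card F = ∑ j ∈ s, a j ^ Fintype.card F := by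
  simpa using sum_pow_card_pow F s a 1

/-- An element fixed by the `#F`-power map comes from `F`. -/
theorem exists_algebraMap_eq_of_pow_card_eq {z : Ω} (hz : z ^ Fintype.card F = z) :
    ∃ a : F, algebraMap F Ω a = z := by
  have hs : (X ^ Fintype.card F - X : F[X]).Splits := by
    rw [splits_iff_card_roots, FiniteField.roots_X_pow_card_sub_X,
      FiniteField.X_pow_card_sub_X_natDegree_eq F Fintype.one_lt_card]
    rfl
  exact hs.mem_range_of_isRoot (FiniteField.X_pow_card_sub_X_ne_zero F Fintype.one_lt_card)
    (i := algebraMap F Ω) (by simp [IsRoot, hz])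

/-- These elements form the kernel of `X ^ M - 1` evaluated at the Frobenius. -/
theorem card_pow_card_pow_eq_self [IsAlgClosed Ω] {M : ℕ} (hM : 0 < M) :
    Nat.card {z : Ω // z ^ Fintype.card F ^ M = z} = Fintype.card F ^ M := by
  have h := card_ker_aeval_frobenius (F := F) Fintype.one_lt_card (Nat.cast_card_eq_zero F)
    (FiniteField.frobeniusAlgHom F Ω).toLinearMap (fun z => rfl) (P := X ^ M - C 1)
    (by simp [coeff_X_pow, hM.ne])
  rw [natDegree_X_pow_sub_C] at h
  refine (Nat.card_congr (Equiv.subtypeEquivRight fun z => ?_)).trans h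
  have hp : ((FiniteField.frobeniusAlgHom F Ω).toLinearMap ^ M) z = z ^ Fintype.card F ^ M := by
    rw [Module.End.pow_apply]
    exact congrFun (pow_iterate _ _) z
  simp [hp, sub_eq_zero]

end FrobeniusPowers

/-! ### Étale `φ`-modules over a finite field: `φ` is a permutation of finite order -/

section Bijective

variable {F K : Type*} [Field F] [Fintype F] [Field K] [Algebra F K]
variable {D : Type*} [AddCommGroup D] [Module K D]

theorem iterate_smul (φ : D →ₛₗ[frob F K] D) (i : ℕ) (k : K) (x : D) :
    φ^[i] (k • x) = k ^ Fintype.card F ^ i • φ^[i] x := by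
  induction i generalizing k x with
  | zero => simp
  | succ i ih =>
    rw [Function.iterate_succ_apply, Function.iterate_succ_apply, map_smulₛₗ, ih, pow_succ',
      pow_mul]
    rfl

theorem iterate_add (φ : D →ₛₗ[frob F K] D) (i : ℕ) (x y : D) :
    φ^[i] (x + y) = φ^[i] x + φ^[i] y :=
  iterate_map_add φ i x y

variable [Finite K] [FiniteDimensional K D]

/-- Frobenius is onto on the finite field `K`, so the image of `φ` is already a subspace and equals
its span. -/
theorem IsEtale.bijective {φ : D →ₛₗ[frob F K] D} (hφ : IsEtale φ) : Function.Bijective φ := by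
  have : Finite D := Module.finite_of_finite K
  have : RingHomSurjective (frob F K) := ⟨Finite.injective_iff_surjective.1 (frob F K).injective⟩
  have hs : Function.Surjective φ := by
    rw [← LinearMap.range_eq_top, ← hφ, ← LinearMap.coe_range, Submodule.span_eq]
  exact ⟨Finite.injective_iff_surjective.2 hs, hs⟩

theorem exists_iterate_eq_id {φ : D →ₛₗ[frob F K] D} (hφ : Function.Bijective φ) :
    ∃ k, 0 < k ∧ φ^[k] = id := by
  have : Finite D := Module.finite_of_finite K
  refine ⟨orderOf (Equiv.ofBijective φ hφ), orderOf_pos _, ?_⟩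
  have h := pow_orderOf_eq_one (Equiv.ofBijective φ hφ)
  funext x
  have h2 := congrArg (fun e : Equiv.Perm D => e x) h
  rwa [← Equiv.Perm.iterate_eq_pow] at h2

end Bijective

end PhiMod

namespace PhiMod

/-! ### Independence and spanning for `Hom_φ(D, Kˢᵉᵖ)` -/

section AssociatedSpace

open Polynomial

instance {K : Type*} [Field K] [Finite K] : IsAlgClosed (SeparableClosure K) :=
  IsAlgClosure.isAlgClosed K

variable {F K : Type*} [Field F] [Fintype F] [Field K] [Algebra F K]
variable {D : Type*} [AddCommGroup D] [Module K D] {φ : D →ₛₗ[frob F K] D}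

theorem assocSpace_apply_iterate (u : assocSpace F φ) (n : ℕ) (x : D) :
    u.1 (φ^[n] x) = u.1 x ^ Fintype.card F ^ n := by
  induction n generalizing x with
  | zero => simp
  | succ n ih => rw [Function.iterate_succ_apply, ih, u.2 x, pow_succ', pow_mul]

/-- The trace construction of elements of `Hom_φ(D, Kˢᵉᵖ)`. -/
theorem exists_assocSpace_eq_sum {M : ℕ} (hM : φ^[M] = id)
    (hK : ∀ k : K, k ^ Fintype.card F ^ M = k) (w : D →ₗ[K] K) {z : SeparableClosure K}
    (hz : z ^ Fintype.card F ^ M = z) :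
    ∃ u : assocSpace F φ, ∀ x, u.1 x = ∑ i ∈ Finset.range M,
      (z * algebraMap K (SeparableClosure K) (w (φ^[M - i] x))) ^ Fintype.card F ^ i := by
  refine ⟨⟨⟨⟨fun x => ∑ i ∈ Finset.range M,
    (z * algebraMap K (SeparableClosure K) (w (φ^[M - i] x))) ^ Fintype.card F ^ i, ?_⟩, ?_⟩, ?_⟩,
    fun x => rfl⟩
  · intro x y
    rw [← Finset.sum_add_distrib]
    refine Finset.sum_congr rfl fun i _ => ?_
    rw [iterate_add, map_add, map_add, mul_add]
    simp only [← frobeniusAlgHom_pow_apply, map_add]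
  · intro k x
    simp only [RingHom.id_apply, Finset.smul_sum]
    refine Finset.sum_congr rfl fun i hi => ?_
    have hi' : i ≤ M := (Finset.mem_range.1 hi).le
    -- The twist by `φ ^ (M - i)` and the outer `q ^ i`-power compose to the `q ^ M`-power, trivial
    -- on `K`.
    have h1 : (k ^ Fintype.card F ^ (M - i)) ^ Fintype.card F ^ i = k := by
      rw [← pow_mul, ← pow_add, Nat.sub_add_cancel hi', hK]
    rw [iterate_smul, map_smul, smul_eq_mul, map_mul, mul_left_comm, mul_pow, ← map_pow, h1,
      Algebra.smul_def]
  · intro x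
    change ∑ i ∈ Finset.range M, _ = (∑ i ∈ Finset.range M, _) ^ Fintype.card F
    rw [sum_pow_card]
    -- The would-be term `i = M` equals the term `i = 0`, so raising to the `q`-th power permutes
    -- the sum cyclically.
    have hz' : (z * algebraMap K (SeparableClosure K) (w (φ^[M - M] (φ x)))) ^ Fintype.card F ^ M =
        (z * algebraMap K (SeparableClosure K) (w (φ^[M - 0] (φ x)))) ^ Fintype.card F ^ 0 := by
      rw [mul_pow, hz, ← map_pow, hK, Nat.sub_self, Nat.sub_zero, hM]
      simp
    have hs := Finset.sum_range_succ (fun i =>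
      (z * algebraMap K (SeparableClosure K) (w (φ^[M - i] (φ x)))) ^ Fintype.card F ^ i) M
    rw [Finset.sum_range_succ', hz'] at hs
    rw [← add_right_cancel hs]
    refine Finset.sum_congr rfl fun i hi => ?_
    have hi' : M - i = M - (i + 1) + 1 := by have := Finset.mem_range.1 hi; omega
    rw [hi', Function.iterate_succ_apply, pow_succ, pow_mul]

variable [Finite K]

/-- `F`-linearly independent elements of `Hom_φ(D, Kˢᵉᵖ)` are `Kˢᵉᵖ`-linearly independent. -/
theorem eq_zero_of_linearIndependent_assocSpace {ι : Type*}
    {u : ι → assocSpace F φ} (hu : LinearIndependent F u) (s : Finset ι)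
    (c : ι → SeparableClosure K) (hc : ∀ x, ∑ j ∈ s, c j * (u j).1 x = 0) :
    ∀ j ∈ s, c j = 0 := by
  classical
  induction s using Finset.induction_on generalizing c with
  | empty => simp
  | insert a s ha ih =>
    by_cases hca : c a = 0
    · have h := ih c fun x => by simpa [Finset.sum_insert ha, hca] using hc x
      intro j hj
      rcases Finset.mem_insert.1 hj with rfl | hj
      exacts [hca, h j hj]
    · exfalso
      have hq : Fintype.card F ≠ 0 := Fintype.card_ne_zero
      -- Artin's argument: normalize the coefficient at `a` to `1`. Evaluating at `φ x` and taking
      -- `q`-th roots yields a second relation; the difference is shorter, so the coefficients are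
      -- Frobenius-fixed and lie in `F`.
      choose e he using fun j => IsAlgClosed.exists_pow_nat_eq (c j / c a) (Fintype.card_pos (α := F))
      have hrel : ∀ x, ∑ j ∈ insert a s, c j / c a * (u j).1 x = 0 := by
        intro x
        have := congrArg (· / c a) (hc x)
        simp only [Finset.sum_div, zero_div] at this
        rw [← this]
        exact Finset.sum_congr rfl fun j _ => by ring
      have hrel2 : ∀ x, ∑ j ∈ insert a s, e j * (u j).1 x = 0 := by
        intro x
        have h := hrel (φ x)
        refine pow_eq_zero_iff hq |>.1 ((sum_pow_card F _ _).trans ?_)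
        rw [← h]
        refine Finset.sum_congr rfl fun j _ => ?_
        rw [mul_pow, he, (u j).2 x]
      have hea : e a = 1 := by
        refine (FiniteField.frobeniusAlgHom F (SeparableClosure K)).injective ?_
        rw [map_one, ← div_self hca]
        exact he a
      have hdiff : ∀ j ∈ s, c j / c a - e j = 0 := by
        refine ih (fun j => c j / c a - e j) fun x => ?_
        have h := congrArg₂ (· - ·) (hrel x) (hrel2 x)
        simpa [Finset.sum_insert ha, hea, div_self hca, sub_mul, Finset.sum_sub_distrib] using h
      have hfix : ∀ j ∈ insert a s, ∃ r : F, algebraMap F (SeparableClosure K) r = e j := by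
        intro j hj
        refine exists_algebraMap_eq_of_pow_card_eq F ?_
        rcases Finset.mem_insert.1 hj with rfl | hj
        · rw [hea, one_pow]
        · rw [he, sub_eq_zero.1 (hdiff j hj)]
      choose! r hr using hfix
      have hrel3 : ∑ j ∈ insert a s, r j • u j = 0 := by
        refine Subtype.ext (LinearMap.ext fun x => ?_)
        rw [Submodule.coe_sum, LinearMap.sum_apply]
        refine Eq.trans (Finset.sum_congr rfl fun j hj => ?_) (hrel2 x)
        rw [← hr j hj, ← Algebra.smul_def, SetLike.val_smul, LinearMap.smul_apply]
      have hra : r a = 0 :=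
        (linearIndependent_iff' (R := F) (M := assocSpace F φ) (v := u)).1 hu (insert a s) r hrel3 a
          (Finset.mem_insert_self a s)
      have := hr a (Finset.mem_insert_self a s)
      rw [hra, map_zero, hea] at this
      exact zero_ne_one this

/-- Every `F`-linear form on `Hom_φ(D, Kˢᵉᵖ)` with values in `Kˢᵉᵖ` is a `Kˢᵉᵖ`-linear combination
of evaluations. -/
theorem exists_eq_sum_of_linearMap {ι : Type*} [Fintype ι]
    (b : Module.Basis ι K D) (h : assocSpace F φ →ₗ[F] SeparableClosure K) :
    ∃ c : ι → SeparableClosure K, ∀ u, h u = ∑ k, c k * u.1 (b k) := by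
  classical
  let B := Module.Basis.ofVectorSpace F (assocSpace F φ)
  let ev : assocSpace F φ →ₗ[F] ι → SeparableClosure K :=
    { toFun := fun u k => u.1 (b k)
      map_add' := fun u v => rfl
      map_smul' := fun a u => rfl }
  -- Since the evaluation vectors of an `F`-basis remain independent over `Kˢᵉᵖ`, the values of `h`
  -- on that basis extend to a `Kˢᵉᵖ`-linear form `l` on coordinate space.
  have hB : LinearIndependent (SeparableClosure K) fun j => ev (B j) := by
    refine linearIndependent_iff'.2 fun s c hc => ?_
    refine eq_zero_of_linearIndependent_assocSpace B.linearIndependent s c fun x => ?_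
    have hk : ∀ k, ∑ j ∈ s, c j * (B j).1 (b k) = 0 := fun k => by
      have h1 := congrFun hc k
      rw [Finset.sum_apply] at h1
      exact h1
    have hlin : ∑ j ∈ s, c j • (B j).1 = 0 := b.ext fun k => by simpa using hk k
    simpa using LinearMap.congr_fun hlin x
  obtain ⟨l, hl⟩ := LinearMap.exists_extend
    ((Module.Basis.span hB).constr (SeparableClosure K) fun j => h (B j))
  have hlB : ∀ j, l (ev (B j)) = h (B j) := by
    intro j
    have h1 := (Module.Basis.span hB).constr_basis (SeparableClosure K) (fun j => h (B j)) j
    rw [← hl] at h1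
    rw [← h1, LinearMap.comp_apply, Submodule.subtype_apply, Module.Basis.span_apply]
  have heq : h = (l.restrictScalars F) ∘ₗ ev := B.ext fun j => (hlB j).symm
  refine ⟨fun k => l (Pi.single k 1), fun u => ?_⟩
  rw [heq]
  change l (ev u) = _
  rw [LinearMap.pi_apply_eq_sum_univ l (ev u)]
  refine Finset.sum_congr rfl fun k _ => ?_
  rw [smul_eq_mul, mul_comm]
  congr 2
  funext i
  simp [Pi.single_apply, eq_comm]

variable [FiniteDimensional K D]

theorem exists_period (hφ : Function.Bijective φ) :
    ∃ M, 0 < M ∧ φ^[M] = id ∧ ∀ k : K, k ^ Fintype.card F ^ M = k := by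
  obtain ⟨m, hm, hφm⟩ := exists_iterate_eq_id hφ
  have hf : Function.Bijective (frob F K) := Finite.injective_iff_bijective.1 (frob F K).injective
  obtain ⟨n, hn, hKn⟩ := exists_iterate_eq_id (F := F) (K := K) (D := K)
    (φ := { toFun := frob F K, map_add' := map_add _, map_smul' := map_mul _ }) hf
  refine ⟨m * n, Nat.mul_pos hm hn, ?_, fun k => ?_⟩
  · rw [Function.iterate_mul, hφm, Function.iterate_id]
  · have h : (frob F K)^[m * n] k = k := by
      have hKn' : (frob F K)^[n] = id := hKn
      rw [mul_comm, Function.iterate_mul, hKn', Function.iterate_id]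
      rfl
    rwa [← congrFun (pow_iterate (Fintype.card F) (m * n)) k]

/-- The space `Hom_φ(D, Kˢᵉᵖ)` spans `Hom_K(D, Kˢᵉᵖ)` over `Kˢᵉᵖ`. -/
theorem eq_zero_of_forall_assocSpace (hφ : Function.Bijective φ) {ι : Type*} [Fintype ι]
    (b : Module.Basis ι K D) (c : ι → SeparableClosure K)
    (hc : ∀ u : assocSpace F φ, ∑ k, c k * u.1 (b k) = 0) : c = 0 := by
  classical
  obtain ⟨M, hM, hφM, hKM⟩ := exists_period hφ
  funext j
  -- Testing the relation on the trace element with parameter `z` and the form `b.coord j` gives a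
  -- polynomial in `z`; `d i` is its coefficient at `z ^ (q ^ i)`.
  set d : ℕ → SeparableClosure K := fun i => ∑ k, c k *
    algebraMap K (SeparableClosure K) (b.coord j (φ^[M - i] (b k))) ^ Fintype.card F ^ i with hd
  set P : (SeparableClosure K)[X] :=
    ∑ i ∈ Finset.range M, C (d i) * X ^ Fintype.card F ^ i with hP
  have hq : 1 < Fintype.card F := Fintype.one_lt_card
  have heval : ∀ z : SeparableClosure K, z ^ Fintype.card F ^ M = z → P.eval z = 0 := by
    intro z hz
    obtain ⟨u, hu⟩ := exists_assocSpace_eq_sum hφM hKM (b.coord j) hz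
    rw [← hc u]
    simp only [hu, hP, eval_finsetSum, eval_mul, eval_C, eval_pow, eval_X, hd, Finset.sum_mul,
      Finset.mul_sum]
    rw [Finset.sum_comm]
    refine Finset.sum_congr rfl fun k _ => Finset.sum_congr rfl fun i _ => ?_
    ring
  have hcard := card_pow_card_pow_eq_self F (Ω := SeparableClosure K) hM
  have hfin : Finite {z : SeparableClosure K // z ^ Fintype.card F ^ M = z} :=
    Nat.finite_of_card_ne_zero (by rw [hcard]; positivity)
  have := Fintype.ofFinite {z : SeparableClosure K // z ^ Fintype.card F ^ M = z}
  -- The degree is at most `q ^ (M - 1)`, but there are `q ^ M` roots.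
  have hP0 : P = 0 := by
    refine eq_zero_of_natDegree_lt_card_of_eval_eq_zero P Subtype.val_injective
      (fun z : {z : SeparableClosure K // z ^ Fintype.card F ^ M = z} => heval z.1 z.2) ?_
    rw [← Nat.card_eq_fintype_card, hcard]
    refine (natDegree_sum_le_of_forall_le (n := Fintype.card F ^ (M - 1)) _ _ fun i hi =>
      (natDegree_C_mul_X_pow_le _ _).trans ?_).trans_lt (Nat.pow_lt_pow_right hq (by omega))
    exact Nat.pow_le_pow_right hq.le (by have := Finset.mem_range.1 hi; omega)
  have hcoeff : P.coeff 1 = d 0 := by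
    rw [hP, finsetSum_coeff, Finset.sum_eq_single 0]
    · simp
    · intro i _ hi
      have : 1 ≠ Fintype.card F ^ i := (Nat.one_lt_pow hi hq).ne
      simp [coeff_X_pow, this]
    · simp [hM.ne']
  rw [hP0, coeff_zero] at hcoeff
  have hφM' : ∀ x, φ^[M] x = x := fun x => congrFun hφM x
  have hd0 : d 0 = c j := by
    rw [hd]
    simp only [Nat.sub_zero, hφM', pow_zero, pow_one]
    simp [Finsupp.single_apply, apply_ite]
  exact hd0.symm.trans hcoeff.symm

/-- As `φ ^ M = id`, every value of `u` satisfies `z ^ (q ^ M) = z`, which leaves finitely many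
values on the finite set `D`. -/
theorem assocSpace_finite (hφ : Function.Bijective φ) : Finite (assocSpace F φ) := by
  obtain ⟨M, hM, hφM, hKM⟩ := exists_period hφ
  have hcard := card_pow_card_pow_eq_self F (Ω := SeparableClosure K) hM
  have hfin : Finite {z : SeparableClosure K // z ^ Fintype.card F ^ M = z} :=
    Nat.finite_of_card_ne_zero (by rw [hcard]; positivity)
  have hD : Finite D := Module.finite_of_finite K
  refine Finite.of_injective (β := D → {z : SeparableClosure K // z ^ Fintype.card F ^ M = z})
    (fun u x => ⟨u.1 x, by rw [← assocSpace_apply_iterate, hφM, id]⟩) fun u v huv => ?_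
  exact Subtype.ext (LinearMap.ext fun x => congrArg Subtype.val (congrFun huv x))

end AssociatedSpace

end PhiMod

namespace PhiMod

/-! ### Generators as equivariant embeddings into `Kˢᵉᵖ` -/

section Generator

open Polynomial

variable {F K : Type*} [Field F] [Fintype F] [Field K] [Algebra F K]
variable {D : Type*} [AddCommGroup D] [Module K D] {φ : D →ₛₗ[frob F K] D}

theorem IsStable.iterate_mem {W : Submodule K D} (hW : IsStable φ W) {x : D} (hx : x ∈ W) (i : ℕ) :
    φ^[i] x ∈ W := by
  induction i with
  | zero => exact hx
  | succ i ih => rw [Function.iterate_succ_apply']; exact hW _ ih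

theorem isStable_span_iterate (x : D) :
    IsStable φ (Submodule.span K (Set.range fun i : ℕ => φ^[i] x)) := by
  intro y hy
  induction hy using Submodule.span_induction with
  | mem y hy =>
    obtain ⟨i, rfl⟩ := hy
    exact Submodule.subset_span ⟨i + 1, Function.iterate_succ_apply' φ i x⟩
  | zero => rw [map_zero]; exact Submodule.zero_mem _
  | add y z _ _ hy hz => rw [map_add]; exact Submodule.add_mem _ hy hz
  | smul a y _ hy => rw [map_smulₛₗ]; exact Submodule.smul_mem _ _ hy

theorem isStable_ker (u : assocSpace F φ) : IsStable φ (LinearMap.ker u.1) := by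
  intro x hx
  rw [LinearMap.mem_ker] at hx ⊢
  rw [u.2 x, hx, zero_pow Fintype.card_ne_zero]

variable [Fintype K]

theorem frobeniusOnRep_apply (u : assocSpace F φ) (x : D) :
    (frobeniusOnRep F φ u).1 x = u.1 x ^ Fintype.card K := rfl

variable [FiniteDimensional K D]

/-- A proper sub-`φ`-module is annihilated by some nonzero element of `Hom_φ(D, Kˢᵉᵖ)`. -/
theorem IsStable.eq_top_of_forall_assocSpace (hφ : Function.Bijective φ) {W : Submodule K D}
    (hW : IsStable φ W) (h : ∀ u : assocSpace F φ, (∀ x ∈ W, u.1 x = 0) → u = 0) : W = ⊤ := by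
  let ψ : (D ⧸ W) →ₛₗ[frob F K] (D ⧸ W) := W.mapQ W φ hW
  have hfin : Finite (D ⧸ W) := Module.finite_of_finite K
  have hψs : Function.Surjective ψ := by
    intro y
    obtain ⟨y, rfl⟩ := W.mkQ_surjective y
    obtain ⟨x, rfl⟩ := hφ.2 y
    exact ⟨W.mkQ x, rfl⟩
  have hψ : Function.Bijective ψ := ⟨Finite.injective_iff_surjective.2 hψs, hψs⟩
  -- Elements of the associated space of `D ⧸ W` pull back to elements for `D` killing `W`.
  have hV : ∀ u : assocSpace F ψ, u = 0 := by
    intro u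
    have h0 := h ⟨u.1 ∘ₗ W.mkQ, fun x => u.2 (W.mkQ x)⟩ fun x hx => by
      rw [LinearMap.comp_apply, Submodule.mkQ_apply, (Submodule.Quotient.mk_eq_zero W).2 hx,
        map_zero]
    refine Subtype.ext (Submodule.linearMap_qext _ ?_)
    exact congrArg Subtype.val h0
  -- With no nonzero `u` to test against, even constant coefficients `1` must vanish, so the basis
  -- is empty.
  have hone := eq_zero_of_forall_assocSpace hψ (Module.finBasis K (D ⧸ W)) (fun _ => 1)
    fun u => by simp [hV u]
  have hdim : Module.finrank K (D ⧸ W) = 0 := by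
    by_contra hne
    exact one_ne_zero (congrFun hone ⟨0, Nat.pos_of_ne_zero hne⟩)
  have := Module.finrank_zero_iff.1 hdim
  exact Submodule.Quotient.subsingleton_iff.1 this

/-- A vector generates `D` if and only if evaluation at it is injective on `Hom_φ(D, Kˢᵉᵖ)`. -/
theorem generates_iff (hφ : Function.Bijective φ) (x : D) :
    Generates φ x ↔ ∀ u : assocSpace F φ, u.1 x = 0 → u = 0 := by
  constructor
  · intro hx u hu
    have hle : Submodule.span K (Set.range fun i : ℕ => φ^[i] x) ≤ LinearMap.ker u.1 := by
      rw [Submodule.span_le]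
      rintro _ ⟨i, rfl⟩
      exact (isStable_ker u).iterate_mem hu i
    rw [Generates] at hx
    rw [hx, top_le_iff, LinearMap.ker_eq_top] at hle
    exact Subtype.ext hle
  · intro h
    refine (isStable_span_iterate x).eq_top_of_forall_assocSpace hφ fun u hu => h u (hu x ?_)
    exact Submodule.subset_span ⟨0, rfl⟩

/-- A Frobenius-equivariant form on `Hom_φ(D, Kˢᵉᵖ)` is the evaluation at a vector of `D`. -/
theorem exists_eq_eval_of_equivariant (hφ : Function.Bijective φ)
    (h : assocSpace F φ →ₗ[F] SeparableClosure K)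
    (hh : ∀ u, h (frobeniusOnRep F φ u) = h u ^ Fintype.card K) :
    ∃ x : D, ∀ u, h u = u.1 x := by
  let b := Module.finBasis K D
  obtain ⟨c, hc⟩ := exists_eq_sum_of_linearMap b h
  -- Equivariance of `h` gives `∑ (c k ^ Q - c k) * u (b k) ^ Q = 0` for `Q = #K`. The `Q`-th root
  -- of this relation has coefficients `d k`, which vanish by the spanning property; hence each `c
  -- k` lies in `K`.
  choose d hd using fun k =>
    IsAlgClosed.exists_pow_nat_eq (c k ^ Fintype.card K - c k) (Fintype.card_pos (α := K))
  have hd0 : d = 0 := by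
    refine eq_zero_of_forall_assocSpace hφ b d fun u => ?_
    refine pow_eq_zero_iff (Fintype.card_ne_zero (α := K)) |>.1 ?_
    have h1 := hh u
    rw [hc, hc, sum_pow_card K] at h1
    rw [sum_pow_card K, ← sub_eq_zero.2 h1.symm, ← Finset.sum_sub_distrib]
    refine Finset.sum_congr rfl fun k _ => ?_
    rw [mul_pow, mul_pow, hd, frobeniusOnRep_apply, sub_mul]
  have hk : ∀ k, ∃ a : K, algebraMap K (SeparableClosure K) a = c k := by
    intro k
    refine exists_algebraMap_eq_of_pow_card_eq K ?_
    rw [← sub_eq_zero, ← hd, hd0, Pi.zero_apply, zero_pow Fintype.card_ne_zero]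
  choose a ha using hk
  refine ⟨∑ k, a k • b k, fun u => ?_⟩
  rw [hc, map_sum]
  refine Finset.sum_congr rfl fun k _ => ?_
  rw [map_smul, Algebra.smul_def, ha]

/-- `D` has a generator if and only if `Hom_φ(D, Kˢᵉᵖ)` embeds equivariantly into `Kˢᵉᵖ`. -/
theorem hasGenerator_iff (hφ : Function.Bijective φ) :
    HasGenerator φ ↔ ∃ h : assocSpace F φ →ₗ[F] SeparableClosure K, Function.Injective h ∧
      ∀ u, h (frobeniusOnRep F φ u) = h u ^ Fintype.card K := by
  constructor
  · rintro ⟨x, hx⟩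
    refine ⟨{ toFun := fun u => u.1 x, map_add' := fun u v => rfl, map_smul' := fun a u => rfl },
      ?_, fun u => rfl⟩
    exact (injective_iff_map_eq_zero _).2 ((generates_iff hφ x).1 hx)
  · rintro ⟨h, hinj, hh⟩
    obtain ⟨x, hx⟩ := exists_eq_eval_of_equivariant hφ h hh
    refine ⟨x, (generates_iff hφ x).2 fun u hu => ?_⟩
    exact hinj ((hx u).trans (hu.trans (map_zero h).symm))

end Generator

end PhiMod

namespace PhiMod

/-! ### The linear operator `φ ^ r` and its annihilating polynomials -/

section LinearPower

open Polynomial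

variable {F K : Type*} [Field F] [Fintype F] [Field K] [Algebra F K]
variable {D : Type*} [AddCommGroup D] [Module K D]
variable {D' : Type*} [AddCommGroup D'] [Module K D']
variable {r : ℕ} (hr : ∀ k : K, k ^ Fintype.card F ^ r = k)

/-- The iterate `φ ^ r`, which is linear when the `q ^ r`-power map is the identity of `K`. -/
def linearPower (φ : D →ₛₗ[frob F K] D) : D →ₗ[K] D where
  toFun := φ^[r]
  map_add' := iterate_add φ r
  map_smul' k x := by rw [iterate_smul, hr, RingHom.id_apply]

/-- The action of a polynomial over `F` in the central element `φ ^ r`. -/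
noncomputable def polyAct (φ : D →ₛₗ[frob F K] D) (p : F[X]) : D →ₗ[K] D :=
  aeval (linearPower hr φ) (p.map (algebraMap F K))

theorem polyAct_mul (φ : D →ₛₗ[frob F K] D) (p p' : F[X]) (x : D) :
    polyAct hr φ (p * p') x = polyAct hr φ p (polyAct hr φ p' x) := by
  simp [polyAct]

theorem map_polyAct {φ : D →ₛₗ[frob F K] D} {ψ : D' →ₛₗ[frob F K] D'} (θ : D →ₗ[K] D')
    (hθ : ∀ x, θ (φ x) = ψ (θ x)) (p : F[X]) (x : D) :
    θ (polyAct hr φ p x) = polyAct hr ψ p (θ x) := by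
  refine LinearMap.apply_aeval_of_comm θ (fun x => ?_) _ x
  exact Function.Semiconj.iterate_right hθ r x

/-- Coefficients from `F` are fixed by the `q`-power map, so the semilinear `φ` passes through them;
kernels of such polynomials are thus sub-`φ`-modules. -/
theorem polyAct_comm (φ : D →ₛₗ[frob F K] D) (p : F[X]) (x : D) :
    φ (polyAct hr φ p x) = polyAct hr φ p (φ x) := by
  unfold polyAct
  induction p using Polynomial.induction_on' generalizing x with
  | add p q hp hq => simp only [Polynomial.map_add, map_add, LinearMap.add_apply, hp, hq]
  | monomial n a =>
    have hn : φ ((linearPower hr φ ^ n) x) = (linearPower hr φ ^ n) (φ x) := by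
      rw [Module.End.pow_apply, Module.End.pow_apply]
      exact ((Function.Commute.refl φ).iterate_right r).iterate_right n x
    have ha : frob F K (algebraMap F K a) = algebraMap F K a :=
      (FiniteField.frobeniusAlgHom F K).commutes a
    simp only [Polynomial.map_monomial, aeval_monomial, Module.End.mul_apply,
      Module.algebraMap_end_apply, map_smulₛₗ, hn, ha]

theorem isStable_ker_polyAct (φ : D →ₛₗ[frob F K] D) (p : F[X]) :
    IsStable φ (LinearMap.ker (polyAct hr φ p)) := by
  intro x hx
  rw [LinearMap.mem_ker] at hx ⊢
  rw [← polyAct_comm, hx, map_zero]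

/-- On a simple `φ`-module, a polynomial killing the module has an irreducible factor which does. -/
theorem IsSimple.exists_irreducible_dvd {φ : D →ₛₗ[frob F K] D} (hφ : IsSimple φ) (p : F[X])
    (hp0 : p ≠ 0) (hp : ∀ x, polyAct hr φ p x = 0) :
    ∃ f, Irreducible f ∧ f ∣ p ∧ ∀ x, polyAct hr φ f x = 0 := by
  obtain ⟨hnt, hsimple⟩ := hφ
  -- Non-injectivity, unlike vanishing, descends from a product to one of its factors; for an
  -- irreducible factor, simplicity turns it back into vanishing.
  suffices h : ¬ Function.Injective (polyAct hr φ p) →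
      ∃ f, Irreducible f ∧ f ∣ p ∧ ∀ x, polyAct hr φ f x = 0 by
    refine h fun hinj => ?_
    obtain ⟨x, hx⟩ := exists_ne (0 : D)
    exact hx (hinj ((hp x).trans (map_zero _).symm))
  clear hp
  induction p using WfDvdMonoid.induction_on_irreducible with
  | zero => exact absurd rfl hp0
  | unit u hu =>
    intro h
    refine absurd (fun x y hxy => ?_) h
    obtain ⟨v, hv⟩ := hu.exists_left_inv
    have hone : ∀ z, polyAct hr φ 1 z = z := fun z => by simp [polyAct]
    rw [← hone x, ← hone y, ← hv, polyAct_mul, polyAct_mul, hxy]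
  | mul p i hp hi ih =>
    intro h
    by_cases hii : Function.Injective (polyAct hr φ i)
    · have hnp : ¬ Function.Injective (polyAct hr φ p) := by
        refine fun hp' => h ?_
        have : ⇑(polyAct hr φ (i * p)) = polyAct hr φ i ∘ polyAct hr φ p :=
          funext fun x => polyAct_mul hr φ i p x
        rw [this]
        exact hii.comp hp'
      obtain ⟨f, hf, hfp, hf0⟩ := ih hp hnp
      exact ⟨f, hf, hfp.mul_left i, hf0⟩
    · refine ⟨i, hi, dvd_mul_right i p, fun x => ?_⟩
      rcases hsimple _ (isStable_ker_polyAct hr φ i) with hb | ht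
      · exact absurd (LinearMap.ker_eq_bot.1 hb) hii
      · rw [LinearMap.ker_eq_top] at ht
        rw [ht, LinearMap.zero_apply]

/-- The polynomial `f` kills the subquotient `M / N` if it maps `M` into `N`. -/
theorem polyAct_subquotientMap_eq_zero_iff {φ : D →ₛₗ[frob F K] D} {N M : Submodule K D}
    (hN : IsStable φ N) (hM : IsStable φ M) (f : F[X]) :
    (∀ y, polyAct hr (subquotientMap φ N M hN hM) f y = 0) ↔
      ∀ x ∈ M, polyAct hr φ f x ∈ N := by
  have key : ∀ x : M, polyAct hr (subquotientMap φ N M hN hM) f ((N.submoduleOf M).mkQ x) = 0 ↔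
      polyAct hr φ f x ∈ N := by
    intro x
    have hsub : (polyAct hr (subMap φ M hM) f x : D) = polyAct hr φ f x :=
      map_polyAct hr (φ := subMap φ M hM) (ψ := φ) M.subtype (fun _ => rfl) f x
    rw [← map_polyAct hr (φ := subMap φ M hM) (N.submoduleOf M).mkQ (fun _ => rfl) f x,
      Submodule.mkQ_apply, Submodule.Quotient.mk_eq_zero, ← hsub]
    rfl
  constructor
  · exact fun h x hx => (key ⟨x, hx⟩).1 (h _)
  · intro h y
    obtain ⟨x, rfl⟩ := (N.submoduleOf M).mkQ_surjective y
    exact (key x).2 (h x x.2)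

/-- If all composition factors are isomorphic, `φ ^ r` is killed by a power of an irreducible
polynomial over `F`. -/
theorem CompositionFactorsIsomorphic.exists_irreducible_pow [Finite K] [FiniteDimensional K D]
    {φ : D →ₛₗ[frob F K] D} (hφ : Function.Bijective φ) (hcomp : CompositionFactorsIsomorphic φ) :
    ∃ f : F[X], Irreducible f ∧ f.Monic ∧ f.coeff 0 ≠ 0 ∧
      ∃ s : ℕ, ∀ x, polyAct hr φ (f ^ s) x = 0 := by
  classical
  obtain ⟨s, hs⟩ := hcomp
  obtain ⟨k, hk, hφk⟩ := exists_iterate_eq_id hφ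
  -- `X ^ k - 1` kills `φ ^ r` because `φ ^ k = id`. Its nonzero constant coefficient forces the
  -- same for the factor `f`.
  have hX0 : (X ^ k - C 1 : F[X]).coeff 0 ≠ 0 := by simp [coeff_X_pow, hk.ne]
  have hX : ∀ x, polyAct hr φ (X ^ k - C 1) x = 0 := by
    intro x
    have h1 : (linearPower hr φ ^ k) x = x := by
      rw [Module.End.pow_apply]
      change (φ^[r])^[k] x = x
      rw [← Function.iterate_mul, mul_comm, Function.iterate_mul, hφk, Function.iterate_id, id]
    simp [polyAct, h1]
  have hXne : (X ^ k - C 1 : F[X]) ≠ 0 := fun h => hX0 (by rw [h, coeff_zero])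
  obtain ⟨f, hf, hfm, hf0, hfi⟩ : ∃ f : F[X], Irreducible f ∧ f.Monic ∧ f.coeff 0 ≠ 0 ∧
      ∀ i y, polyAct hr (s.factorMap i) f y = 0 := by
    by_cases hl : s.length = 0
    -- With no composition factors any admissible `f` will do.
    · refine ⟨X - C 1, irreducible_X_sub_C 1, monic_X_sub_C 1, by simp, fun i => ?_⟩
      exact absurd i.2 (by omega)
    · let i₀ : Fin s.length := ⟨0, Nat.pos_of_ne_zero hl⟩
      have hkill : ∀ y, polyAct hr (s.factorMap i₀) (X ^ k - C 1) y = 0 :=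
        (polyAct_subquotientMap_eq_zero_iff hr _ _ _).2 fun x _ => by
          rw [hX]; exact Submodule.zero_mem _
      obtain ⟨f, hf, hfd, hf0⟩ := (s.simple i₀).exists_irreducible_dvd hr _ hXne hkill
      have hnorm := normalize_associated f
      refine ⟨normalize f, hnorm.symm.irreducible hf, monic_normalize hf.ne_zero, fun h0 => hX0 ?_,
        fun i y => ?_⟩
      · obtain ⟨c, hc⟩ := hnorm.dvd.trans hfd
        rw [hc, mul_coeff_zero, h0, zero_mul]
      · obtain ⟨e, he⟩ := hs i i₀
        obtain ⟨c, hc⟩ := hnorm.symm.dvd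
        refine e.injective ?_
        have hf0' : ∀ z, polyAct hr (s.factorMap i₀) f z = 0 := hf0
        have h := map_polyAct hr (φ := s.factorMap i) (ψ := s.factorMap i₀) e.toLinearMap he
          (normalize f) y
        rw [LinearEquiv.coe_toLinearMap] at h
        rw [h, map_zero, hc, mul_comm, polyAct_mul, hf0', map_zero]
  refine ⟨f, hf, hfm, hf0, s.length, ?_⟩
  -- Each application of `f` descends one step of the series.
  have hstep : ∀ i : Fin (s.length + 1), ∀ x ∈ s.term i, polyAct hr φ (f ^ (i : ℕ)) x = 0 := by
    intro i
    induction i using Fin.induction with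
    | zero =>
      intro x hx
      rw [s.bot, Submodule.mem_bot] at hx
      rw [hx, map_zero]
    | succ i ih =>
      intro x hx
      rw [Fin.val_succ, pow_succ, polyAct_mul]
      exact ih _ ((polyAct_subquotientMap_eq_zero_iff hr _ _ f).1 (hfi i) x hx)
  intro x
  exact hstep (Fin.last s.length) x (by rw [s.top]; exact Submodule.mem_top)

/-- Polynomials in the Frobenius element act on `Hom_φ(D, Kˢᵉᵖ)` by the transpose of their action
on `D`. -/
theorem aeval_frobeniusOnRep_apply [Fintype K] (hK : Fintype.card K = Fintype.card F ^ r)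
    (φ : D →ₛₗ[frob F K] D) (p : F[X]) (u : assocSpace F φ) (x : D) :
    (aeval (frobeniusOnRep F φ) p u).1 x = u.1 (polyAct hr φ p x) := by
  unfold polyAct
  induction p using Polynomial.induction_on' with
  | add p q hp hq =>
    simp only [Polynomial.map_add, map_add, LinearMap.add_apply, Submodule.coe_add, hp, hq]
  | monomial n a =>
    have hn : ∀ x, ((frobeniusOnRep F φ ^ n) u).1 x = u.1 ((linearPower hr φ ^ n) x) := by
      induction n with
      | zero => intro x; simp
      | succ n ih =>
        intro x
        rw [pow_succ', pow_succ, Module.End.mul_apply, Module.End.mul_apply, frobeniusOnRep_apply,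
          ih, ← ih, hK, ← assocSpace_apply_iterate, ih]
        rfl
    simp only [Polynomial.map_monomial, aeval_monomial, Module.End.mul_apply,
      Module.algebraMap_end_apply, map_smul, SetLike.val_smul, LinearMap.smul_apply, hn,
      algebraMap_smul]

end LinearPower

end PhiMod

namespace PhiMod

/-! ### The generator criterion in terms of the kernel of `f` -/

section CardinalityCriterion

open Polynomial

variable {F K : Type*} [Field F] [Fintype F] [Field K] [Fintype K] [Algebra F K]
variable {D : Type*} [AddCommGroup D] [Module K D] [FiniteDimensional K D]

theorem exists_frobenius_linearMap {r : ℕ} (hK : Fintype.card K = Fintype.card F ^ r) :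
    ∃ Φ : SeparableClosure K →ₗ[F] SeparableClosure K, (∀ z, Φ z = z ^ Fintype.card K) ∧
      (∀ p : F[X], p ≠ 0 → Function.Surjective (aeval Φ p)) ∧
      ∀ p : F[X], p.coeff 0 ≠ 0 →
        Nat.card (LinearMap.ker (aeval Φ p)) = (Fintype.card F ^ r) ^ p.natDegree := by
  have hQ : 1 < Fintype.card K := Fintype.one_lt_card
  -- Positivity of `r` is automatic, since a field has more than one element.
  have hr : r ≠ 0 := by
    rintro rfl
    rw [hK, pow_zero] at hQ
    exact lt_irrefl _ hQ
  have hQ0 : (Fintype.card K : F) = 0 := by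
    rw [hK, Nat.cast_pow, Nat.cast_card_eq_zero, zero_pow hr]
  obtain ⟨Φ, hΦ⟩ : ∃ Φ : SeparableClosure K →ₗ[F] SeparableClosure K,
      ∀ z, Φ z = z ^ Fintype.card K :=
    ⟨(FiniteField.frobeniusAlgHom K (SeparableClosure K)).toLinearMap.restrictScalars F,
      fun _ => rfl⟩
  refine ⟨Φ, hΦ, fun p hp => aeval_frobenius_surjective hQ Φ hΦ hp, fun p hp => ?_⟩
  rw [← hK]
  exact card_ker_aeval_frobenius hQ hQ0 Φ hΦ hp

/-- When `φ ^ r` is killed by a power of an irreducible polynomial `f`, the existence of a generator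
is read off from the size of the kernel of `f` of the Frobenius element. -/
theorem hasGenerator_iff_card_ker_le {φ : D →ₛₗ[frob F K] D} (hφ : Function.Bijective φ) {r : ℕ}
    (hK : Fintype.card K = Fintype.card F ^ r) {f : F[X]} (hf : Irreducible f)
    (hf0 : f.coeff 0 ≠ 0) {s : ℕ} (hs : aeval (frobeniusOnRep F φ) (f ^ s) = 0) :
    HasGenerator φ ↔ Nat.card (LinearMap.ker (aeval (frobeniusOnRep F φ) f)) ≤
      (Fintype.card F ^ r) ^ f.natDegree := by
  obtain ⟨Φ, hΦ, hsurj, hcard⟩ := exists_frobenius_linearMap hK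
  have hVfin : Finite (assocSpace F φ) := assocSpace_finite hφ
  have hfin : Finite (LinearMap.ker (aeval Φ f)) :=
    Nat.finite_of_card_ne_zero (by rw [hcard f hf0]; positivity)
  have h := LinearMap.exists_injective_comm_iff_card_ker_le (V := assocSpace F φ)
    (W := SeparableClosure K) (g := frobeniusOnRep F φ) (g' := Φ) (s := s) hf hs hsurj hfin
  rw [hcard f hf0] at h
  simp only [hΦ] at h
  exact (hasGenerator_iff hφ).trans h

end CardinalityCriterion

end PhiMod

namespace PhiMod

/-! ### Jordan blocks as nilpotent perturbations -/

section JordanOperator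

open Polynomial

variable {F : Type*} [Field F] {M : Type*} [AddCommGroup M] [Module F M]

variable (F M) in
/-- The shift `(v₀, …, v_{t-1}) ↦ (v₁, …, v_{t-1}, 0)`. -/
def shiftMap (t : ℕ) : (Fin t → M) →ₗ[F] Fin t → M where
  toFun v i := if h : (i : ℕ) + 1 < t then v ⟨i + 1, h⟩ else 0
  map_add' v w := by
    funext i
    by_cases h : (i : ℕ) + 1 < t <;> simp [h]
  map_smul' c v := by
    funext i
    by_cases h : (i : ℕ) + 1 < t <;> simp [h]

theorem shiftMap_apply {t : ℕ} (v : Fin t → M) (i : Fin t) :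
    shiftMap F M t v i = if h : (i : ℕ) + 1 < t then v ⟨i + 1, h⟩ else 0 := rfl

theorem shiftMap_pow_apply {t : ℕ} (k : ℕ) (v : Fin t → M) (i : Fin t) :
    (shiftMap F M t ^ k) v i = if h : (i : ℕ) + k < t then v ⟨i + k, h⟩ else 0 := by
  induction k generalizing i with
  | zero => simp
  | succ k ih =>
    rw [pow_succ', Module.End.mul_apply, shiftMap_apply]
    by_cases h1 : (i : ℕ) + 1 < t
    · simp only [h1, dif_pos, ih, add_assoc, add_comm 1 k]
    · rw [dif_neg h1, dif_neg (by omega)]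

theorem shiftMap_pow_eq_zero (t : ℕ) : shiftMap F M t ^ t = 0 := by
  refine LinearMap.ext fun v => funext fun i => ?_
  rw [shiftMap_pow_apply, dif_neg (by omega)]
  rfl

theorem shiftMap_pow_pred_ne_zero [Nontrivial M] {t : ℕ} (ht : 0 < t) :
    shiftMap F M t ^ (t - 1) ≠ 0 := by
  obtain ⟨x, hx⟩ := exists_ne (0 : M)
  intro h
  have h1 := congrFun (LinearMap.congr_fun h fun _ => x) ⟨0, ht⟩
  rw [shiftMap_pow_apply, dif_pos (by simp; omega)] at h1
  exact hx h1

/-- The operator `v ↦ a v + N v` on `Mᵗ`, where `N` is the shift: the Jordan block of length `t`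
attached to the endomorphism `a`. -/
def jordanMap (a : M →ₗ[F] M) (t : ℕ) : (Fin t → M) →ₗ[F] Fin t → M :=
  a.compLeft (Fin t) + shiftMap F M t

theorem jordanMap_apply (a : M →ₗ[F] M) {t : ℕ} (v : Fin t → M) (i : Fin t) :
    jordanMap a t v i = a (v i) + shiftMap F M t v i := rfl

/-- A polynomial `f` with simple roots, killing `b`, takes at a nilpotent perturbation `b + n` the
value `n` up to a unit. -/
theorem exists_aeval_add_eq_mul_unit {S : Type*} [CommRing S] [Algebra F S] {f : F[X]}
    (hf : f.Separable) {b n : S} (hb : aeval b f = 0) (hn : IsNilpotent n) :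
    ∃ u : S, IsUnit u ∧ aeval (b + n) f = n * u := by
  -- Taylor expansion gives `f(b + n) = n * (f'(b) + k * n)`, where `f'(b)` is a unit by the Bézout
  -- identity for `f` and `f'`.
  obtain ⟨k, hk⟩ := binomExpansion (f.map (algebraMap F S)) b n
  rw [eval_map_algebraMap, eval_map_algebraMap, hb, derivative_map, eval_map_algebraMap] at hk
  refine ⟨aeval b (derivative f) + k * n, ?_, by rw [hk]; ring⟩
  refine IsNilpotent.isUnit_add_left_of_commute ?_ ?_
    (Commute.all _ _)
  · exact (Commute.all k n).isNilpotent_mul_left hn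
  · obtain ⟨u, v, huv⟩ := hf
    refine isUnit_iff_exists_inv'.2 ⟨aeval b v, ?_⟩
    have h := congrArg (aeval b) huv
    rwa [map_add, map_mul, map_mul, hb, mul_zero, zero_add, map_one] at h

theorem exists_aeval_map_add_eq_mul_unit {S E : Type*} [CommRing S] [Algebra F S] [Ring E]
    [Algebra F E] (ι : S →ₐ[F] E) (hι : Function.Injective ι) {f : F[X]} (hf : f.Separable)
    (b n : S) (hb : aeval (ι b) f = 0) (hn : IsNilpotent (ι n)) :
    ∃ u : E, IsUnit u ∧ Commute (ι n) u ∧ aeval (ι b + ι n) f = ι n * u := by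
  rw [aeval_algHom_apply] at hb
  obtain ⟨u, hu, hfu⟩ := exists_aeval_add_eq_mul_unit hf (hι (hb.trans (map_zero ι).symm))
    ((IsNilpotent.map_iff hι).1 hn)
  refine ⟨ι u, hu.map ι, (Commute.all n u).map ι, ?_⟩
  rw [← map_add, aeval_algHom_apply, hfu, map_mul]

/-- The commuting elements `b` and `n` generate a commutative subalgebra, where the Taylor argument
applies. -/
theorem exists_aeval_add_eq_mul_unit_of_commute {E : Type*} [Ring E] [Algebra F E] {f : F[X]}
    (hf : f.Separable) {b n : E} (hbn : Commute b n) (hb : aeval b f = 0) (hn : IsNilpotent n) :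
    ∃ u : E, IsUnit u ∧ Commute n u ∧ aeval (b + n) f = n * u := by
  have hcomm : ∀ x ∈ ({b, n} : Set E), ∀ y ∈ ({b, n} : Set E), x * y = y * x := by
    rintro x (rfl | rfl) y (rfl | rfl)
    exacts [rfl, hbn, hbn.symm, rfl]
  have hmul := Algebra.isMulCommutative_adjoin F hcomm
  let _ : CommRing (Algebra.adjoin F ({b, n} : Set E)) :=
    { (inferInstance : Ring (Algebra.adjoin F ({b, n} : Set E))) with
      mul_comm := fun x y => hmul.is_comm.comm x y }
  exact exists_aeval_map_add_eq_mul_unit (S := Algebra.adjoin F ({b, n} : Set E))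
    (Algebra.adjoin F ({b, n} : Set E)).val Subtype.val_injective hf
    ⟨b, Algebra.subset_adjoin (by simp)⟩ ⟨n, Algebra.subset_adjoin (by simp)⟩ hb hn

/-- The coordinatewise action of `a` commutes with the nilpotent shift. Kernels and nilpotency of
`f` on a Jordan block are thereby read off from the shift. -/
theorem exists_aeval_jordanMap_eq {a : M →ₗ[F] M} {f : F[X]} (hf : f.Separable)
    (ha : aeval a f = 0) (t : ℕ) : ∃ u : Module.End F (Fin t → M), IsUnit u ∧
      Commute (shiftMap F M t) u ∧ aeval (jordanMap a t) f = shiftMap F M t * u := by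
  refine exists_aeval_add_eq_mul_unit_of_commute (E := Module.End F (Fin t → M)) hf ?_ ?_
    ⟨t, shiftMap_pow_eq_zero t⟩
  · refine LinearMap.ext fun v => funext fun i => ?_
    change a (shiftMap F M t v i) = shiftMap F M t (fun j => a (v j)) i
    rw [shiftMap_apply, shiftMap_apply]
    split_ifs
    · rfl
    · exact map_zero a
  · refine LinearMap.ext fun v => funext fun i => ?_
    have h2 := LinearMap.apply_aeval_of_comm (g := a.compLeft (Fin t)) (g' := a)
      (LinearMap.proj i) (fun _ => rfl) f v
    rw [ha] at h2
    exact h2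

/-- The kernel of the shift consists of the vectors concentrated at the index `0`. -/
theorem mem_ker_shiftMap_iff {t : ℕ} (ht : 0 < t) {v : Fin t → M} :
    v ∈ LinearMap.ker (shiftMap F M t) ↔ v = Pi.single ⟨0, ht⟩ (v ⟨0, ht⟩) := by
  rw [LinearMap.mem_ker]
  constructor
  · intro h
    funext i
    rcases i with ⟨_ | i, hi⟩
    · simp
    · have h1 := congrFun h ⟨i, by omega⟩
      rw [shiftMap_apply, dif_pos hi] at h1
      rw [Pi.single_eq_of_ne (by simp [Fin.ext_iff])]
      exact h1
  · intro h
    funext i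
    rw [h, shiftMap_apply]
    split_ifs
    · rw [Pi.single_eq_of_ne (by simp [Fin.ext_iff])]
      rfl
    · rfl

theorem card_ker_shiftMap {t : ℕ} (ht : 0 < t) :
    Nat.card (LinearMap.ker (shiftMap F M t)) = Nat.card M := by
  refine Nat.card_congr ⟨fun v => v.1 ⟨0, ht⟩, fun x => ⟨Pi.single ⟨0, ht⟩ x, ?_⟩, fun v => ?_,
    fun x => ?_⟩
  · rw [mem_ker_shiftMap_iff ht, Pi.single_eq_same]
  · exact Subtype.ext ((mem_ker_shiftMap_iff ht).1 v.2).symm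
  · exact Pi.single_eq_same (M := fun _ : Fin t => M) (⟨0, ht⟩ : Fin t) x

theorem card_ker_aeval_jordanMap {a : M →ₗ[F] M} {f : F[X]} (hf : f.Separable)
    (ha : aeval a f = 0) {t : ℕ} (ht : 0 < t) :
    Nat.card (LinearMap.ker (aeval (jordanMap a t) f)) = Nat.card M := by
  obtain ⟨u, hu, hcomm, hfu⟩ := exists_aeval_jordanMap_eq hf ha t
  rw [hfu, hcomm.eq, ← card_ker_shiftMap (F := F) (M := M) ht]
  have hinj : Function.Injective u := ((Module.End.isUnit_iff u).1 hu).1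
  refine Nat.card_congr (Equiv.subtypeEquivRight fun v => ?_)
  rw [LinearMap.mem_ker, LinearMap.mem_ker, Module.End.mul_apply]
  exact ⟨fun h => hinj (h.trans (map_zero u).symm), fun h => by rw [h, map_zero]⟩

theorem aeval_jordanMap_pow_eq_zero {a : M →ₗ[F] M} {f : F[X]} (hf : f.Separable)
    (ha : aeval a f = 0) (t : ℕ) : aeval (jordanMap a t) (f ^ t) = 0 := by
  obtain ⟨u, hu, hcomm, hfu⟩ := exists_aeval_jordanMap_eq hf ha t
  rw [map_pow, hfu, hcomm.mul_pow, shiftMap_pow_eq_zero, zero_mul]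

theorem aeval_jordanMap_pow_pred_ne_zero [Nontrivial M] {a : M →ₗ[F] M} {f : F[X]}
    (hf : f.Separable) (ha : aeval a f = 0) {t : ℕ} (ht : 0 < t) :
    aeval (jordanMap a t) (f ^ (t - 1)) ≠ 0 := by
  obtain ⟨u, hu, hcomm, hfu⟩ := exists_aeval_jordanMap_eq hf ha t
  rw [map_pow, hfu, hcomm.mul_pow]
  intro h
  exact shiftMap_pow_pred_ne_zero ht ((hu.pow (t - 1)).mul_left_eq_zero.1 h)

/-- A polynomial killing the Jordan block of `a` kills `a`. -/
theorem aeval_eq_zero_of_aeval_jordanMap {a : M →ₗ[F] M} {p : F[X]} {t : ℕ} (ht : 0 < t)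
    (hp : aeval (jordanMap a t) p = 0) : aeval a p = 0 := by
  refine LinearMap.ext fun x => ?_
  -- The shift kills vectors concentrated at index `0`, so this copy of `M` carries the action of
  -- `a` alone.
  have hcomm : ∀ x, LinearMap.single F (fun _ : Fin t => M) ⟨0, ht⟩ (a x) =
      jordanMap a t (LinearMap.single F (fun _ : Fin t => M) ⟨0, ht⟩ x) := by
    intro x
    have hker : shiftMap F M t (Pi.single ⟨0, ht⟩ x) = 0 :=
      (mem_ker_shiftMap_iff ht).2 (by rw [Pi.single_eq_same])
    funext i
    rw [LinearMap.single_apply, LinearMap.single_apply, jordanMap_apply, hker, Pi.zero_apply,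
      add_zero]
    exact (Pi.apply_single (fun _ => a) (fun _ => map_zero a) _ _ _).symm
  have h := LinearMap.apply_aeval_of_comm _ hcomm p x
  rw [hp, LinearMap.zero_apply] at h
  simpa using h

end JordanOperator

/-! ### Cyclicity of a Jordan block -/

section Cyclic

open Polynomial

variable {F : Type*} [Field F] {V : Type*} [AddCommGroup V] [Module F V] [FiniteDimensional F V]

/-- An endomorphism killed by `f ^ t` but not by `f ^ (t - 1)`, on a space of dimension
`t * deg f`, is cyclic. -/
theorem nonempty_linearEquiv_quotient_span_pow {g : V →ₗ[F] V} {f : F[X]} (hf : Irreducible f)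
    {t : ℕ} (ht : 0 < t) (h0 : aeval g (f ^ t) = 0) (h1 : aeval g (f ^ (t - 1)) ≠ 0)
    (hdim : Module.finrank F V = t * f.natDegree) :
    Nonempty (Module.AEval' g ≃ₗ[F[X]] F[X] ⧸ Submodule.span F[X] {f ^ t}) := by
  obtain ⟨v, hv⟩ : ∃ v, aeval g (f ^ (t - 1)) v ≠ 0 := by
    by_contra! h
    exact h1 (LinearMap.ext h)
  let θ : F[X] →ₗ[F[X]] Module.AEval' g := LinearMap.toSpanSingleton F[X] _ (Module.AEval'.of g v)
  have hθ : ∀ p, p ∈ LinearMap.ker θ ↔ aeval g p v = 0 := by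
    intro p
    rw [LinearMap.mem_ker, LinearMap.toSpanSingleton_apply, ← Module.AEval.of_aeval_smul]
    simp
  -- The annihilator of `v` is generated by a divisor of `f ^ t` that does not divide `f ^ (t - 1)`.
  -- Comparing dimensions then makes `v` a generator.
  have hker : LinearMap.ker θ = Submodule.span F[X] {f ^ t} := by
    have hpr : Submodule.IsPrincipal (LinearMap.ker θ) := IsPrincipalIdealRing.principal _
    obtain ⟨c, hc⟩ := hpr
    have hct : c ∣ f ^ t := by
      have : f ^ t ∈ LinearMap.ker θ := (hθ _).2 (by rw [h0, LinearMap.zero_apply])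
      rw [hc] at this
      exact Ideal.mem_span_singleton.1 this
    obtain ⟨k, hk, hck⟩ := (dvd_prime_pow hf.prime t).1 hct
    rcases hk.lt_or_eq with hlt | rfl
    · refine absurd ((hθ _).1 ?_) hv
      rw [hc]
      exact Ideal.mem_span_singleton.2 (hck.dvd.trans (pow_dvd_pow f (by omega)))
    · rw [hc]
      exact Ideal.span_singleton_eq_span_singleton.2 hck
  let e : (F[X] ⧸ Submodule.span F[X] {f ^ t}) →ₗ[F[X]] Module.AEval' g :=
    (Submodule.span F[X] {f ^ t}).liftQ θ hker.ge
  have hinj : Function.Injective e := by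
    rw [← LinearMap.ker_eq_bot, Submodule.ker_liftQ_eq_bot _ _ _ hker.le]
  have hne : f ^ t ≠ 0 := pow_ne_zero _ hf.ne_zero
  have hfd : FiniteDimensional F (AdjoinRoot (f ^ t)) := (AdjoinRoot.powerBasis hne).finite
  have hfr : Module.finrank F (AdjoinRoot (f ^ t)) = t * f.natDegree := by
    rw [(AdjoinRoot.powerBasis hne).finrank, AdjoinRoot.powerBasis_dim, natDegree_pow]
  have hfr' : Module.finrank F (Module.AEval' g) = t * f.natDegree := by
    rw [← hdim]
    exact (Module.AEval'.of g).finrank_eq.symm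
  have hfdA : FiniteDimensional F (Module.AEval' g) := Module.Finite.equiv (Module.AEval'.of g)
  have hsurj : Function.Surjective e := by
    have := LinearMap.injective_iff_surjective_of_finrank_eq_finrank (K := F)
      (V := AdjoinRoot (f ^ t)) (V₂ := Module.AEval' g) (f := e.restrictScalars F)
      (hfr.trans hfr'.symm)
    exact this.1 hinj
  exact ⟨(LinearEquiv.ofBijective e ⟨hinj, hsurj⟩).symm⟩

end Cyclic

end PhiMod

namespace PhiMod

/-! ### Existence of Jordan forms and the number of blocks -/

section JordanForm

open Polynomial

variable {F : Type*} [Field F]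

/-- Currying of coordinate vectors of a block decomposition. -/
def blockCurry {m : ℕ} (n t : Fin m → ℕ) :
    ((Σ i : Fin m, Fin (t i) × Fin (n i)) → F) ≃ₗ[F] (∀ i, Fin (t i) → Fin (n i) → F) where
  toFun w i j k := w ⟨i, (j, k)⟩
  map_add' _ _ := rfl
  map_smul' _ _ := rfl
  invFun w x := w x.1 x.2.1 x.2.2
  left_inv _ := rfl
  right_inv _ := rfl

theorem jordanBlock_mulVec {n : ℕ} (A : Matrix (Fin n) (Fin n) F) (t : ℕ)
    (w : Fin t → Fin n → F) (j : Fin t) (k : Fin n) :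
    ∑ y : Fin t × Fin n, jordanBlock A t (j, k) y * w y.1 y.2 =
      jordanMap (Matrix.toLin' A) t w j k := by
  have hsplit : ∀ y : Fin t × Fin n, jordanBlock A t (j, k) y * w y.1 y.2 =
      (if j = y.1 then A k y.2 * w y.1 y.2 else 0) +
        if (j : ℕ) + 1 = y.1 then (1 : Matrix (Fin n) (Fin n) F) k y.2 * w y.1 y.2 else 0 := by
    intro y
    simp only [jordanBlock, Matrix.of_apply]
    by_cases h1 : j = y.1
    · have h2 : ¬ ((j : ℕ) + 1 = y.1) := by rw [h1]; omega
      simp [h1]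
    · by_cases h2 : (j : ℕ) + 1 = y.1 <;> simp [h1, h2]
  simp only [hsplit, Finset.sum_add_distrib, Fintype.sum_prod_type]
  rw [jordanMap_apply, Pi.add_apply, shiftMap_apply]
  congr 1
  · rw [Finset.sum_eq_single j]
    · simp [Matrix.mulVec, dotProduct]
    · intro j' _ hj'
      simp [hj'.symm]
    · simp
  · by_cases h : (j : ℕ) + 1 < t
    · rw [dif_pos h, Finset.sum_eq_single ⟨(j : ℕ) + 1, h⟩]
      · simp [Matrix.one_apply]
      · intro j' _ hj'
        have : ¬ ((j : ℕ) + 1 = j') := fun h' => hj' (Fin.ext h'.symm)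
        simp [this]
      · simp
    · rw [dif_neg h]
      refine Finset.sum_eq_zero fun j' _ => ?_
      have : ¬ ((j : ℕ) + 1 = j') := by omega
      simp [this]

theorem blockCurry_blockDiagonal_mulVec {m : ℕ} (n t : Fin m → ℕ)
    (A : ∀ i, Matrix (Fin (n i)) (Fin (n i)) F) (w : (Σ i : Fin m, Fin (t i) × Fin (n i)) → F)
    (i : Fin m) :
    blockCurry n t (Matrix.mulVec
      (Matrix.blockDiagonal' fun i => jordanBlock (A i) (t i)) w) i =
      jordanMap (Matrix.toLin' (A i)) (t i) (blockCurry n t w i) := by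
  funext j k
  rw [← jordanBlock_mulVec]
  change ∑ x, Matrix.blockDiagonal' (fun i => jordanBlock (A i) (t i)) ⟨i, (j, k)⟩ x * w x = _
  rw [Fintype.sum_sigma, Finset.sum_eq_single i]
  · refine Finset.sum_congr rfl fun y _ => ?_
    rw [Matrix.blockDiagonal'_apply_eq]
    rfl
  · intro i' _ hi'
    refine Finset.sum_eq_zero fun y _ => ?_
    rw [Matrix.blockDiagonal'_apply_ne _ _ _ hi'.symm, zero_mul]
  · simp

theorem aeval_toLin' {n : ℕ} (A : Matrix (Fin n) (Fin n) F) (p : F[X]) :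
    aeval (Matrix.toLin' A) p = Matrix.toLin' (aeval A p) :=
  aeval_algHom_apply (Matrix.toLinAlgEquiv' (R := F) (n := Fin n)).toAlgHom A p

variable {V : Type*} [AddCommGroup V] [Module F V]

/-- A Jordan form with `m` blocks is a decomposition into `m` Jordan operators. -/
theorem hasJordanFormWithBlocks_iff (g : V →ₗ[F] V) (m : ℕ) :
    HasJordanFormWithBlocks g m ↔
      ∃ (n t : Fin m → ℕ) (A : ∀ i, Matrix (Fin (n i)) (Fin (n i)) F)
        (e : V ≃ₗ[F] (∀ i, Fin (t i) → Fin (n i) → F)),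
        (∀ i, 0 < t i) ∧ (∀ i, Irreducible (A i).charpoly) ∧
          ∀ v i, e (g v) i = jordanMap (Matrix.toLin' (A i)) (t i) (e v i) := by
  classical
  constructor
  · rintro ⟨n, t, A, b, ht, hA, hb⟩
    refine ⟨n, t, A, b.equivFun.trans (blockCurry n t), ht, hA, fun v i => ?_⟩
    have hmat : LinearMap.toMatrix b b g =
        Matrix.blockDiagonal' fun i => jordanBlock (A i) (t i) := by
      ext x y
      rw [LinearMap.toMatrix_apply, hb]
    have h := LinearMap.toMatrix_mulVec_repr b b g v
    rw [LinearEquiv.trans_apply, LinearEquiv.trans_apply, ← blockCurry_blockDiagonal_mulVec, ← hmat]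
    exact congrFun (congrArg (blockCurry n t) h.symm) i
  · rintro ⟨n, t, A, e, ht, hA, he⟩
    refine ⟨n, t, A, Module.Basis.ofEquivFun (e.trans (blockCurry n t).symm), ht, hA, ?_⟩
    set b := Module.Basis.ofEquivFun (e.trans (blockCurry n t).symm) with hb
    have hrepr : ∀ v, ⇑(b.repr v) = (blockCurry n t).symm (e v) := fun v => rfl
    intro x y
    have hfun : (blockCurry n t).symm (e (g (b y))) = Matrix.mulVec
        (Matrix.blockDiagonal' fun i => jordanBlock (A i) (t i)) (Pi.single y 1) := by
      rw [LinearEquiv.symm_apply_eq]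
      funext i
      rw [blockCurry_blockDiagonal_mulVec, he]
      congr 2
      have hy : ⇑(b.repr (b y)) = Pi.single y 1 := by
        rw [b.repr_self, Finsupp.single_eq_pi_single]
      rw [← hy, hrepr, LinearEquiv.apply_symm_apply]
    rw [hrepr, hfun, Matrix.mulVec_single_one]
    rfl

/-- In a Jordan form of an endomorphism killed by a power of `f`, the number of blocks is read off
from the size of the kernel of `f`. -/
theorem HasJordanFormWithBlocks.card_ker [Fintype F] {g : V →ₗ[F] V} {m : ℕ}
    (hg : HasJordanFormWithBlocks g m) {f : F[X]} (hf : Irreducible f) (hfm : f.Monic) {s : ℕ}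
    (hs : aeval g (f ^ s) = 0) :
    Nat.card (LinearMap.ker (aeval g f)) = Fintype.card F ^ (m * f.natDegree) := by
  obtain ⟨n, t, A, e, ht, hA, he⟩ := (hasJordanFormWithBlocks_iff g m).1 hg
  have hcomm : ∀ i (p : F[X]) v,
      e (aeval g p v) i = aeval (jordanMap (Matrix.toLin' (A i)) (t i)) p (e v i) := fun i p v =>
    LinearMap.apply_aeval_of_comm (LinearMap.proj i ∘ₗ e.toLinearMap) (fun v => he v i) p v
  -- Since `f ^ s` kills `A i`, its minimal polynomial is a nontrivial power of `f`. So `f` divides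
  -- the irreducible characteristic polynomial.
  have hchar : ∀ i, (A i).charpoly = f := by
    intro i
    have h1 : aeval (jordanMap (Matrix.toLin' (A i)) (t i)) (f ^ s) = 0 := by
      refine LinearMap.ext fun w => ?_
      obtain ⟨v, hv⟩ := e.surjective (Pi.single i w)
      have h := hcomm i (f ^ s) v
      rw [hs, hv, Pi.single_eq_same] at h
      rw [← h, LinearMap.zero_apply, map_zero]
      rfl
    have h2 : aeval (A i) (f ^ s) = 0 := by
      have h := aeval_eq_zero_of_aeval_jordanMap (ht i) h1
      rw [aeval_toLin'] at h
      exact (map_eq_zero_iff _ Matrix.toLin'.injective).1 h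
    have hne : ¬ IsUnit (minpoly F (A i)) := by
      intro hu
      have h := congrArg (aeval (A i)) ((minpoly.monic (Matrix.isIntegral (A i))).eq_one_of_isUnit hu)
      rw [minpoly.aeval, map_one] at h
      have hn : Nontrivial (Matrix (Fin (n i)) (Fin (n i)) F) := by
        have : Nonempty (Fin (n i)) := by
          have hpos := (hA i).natDegree_pos
          rw [Matrix.charpoly_natDegree_eq_dim] at hpos
          exact Fintype.card_pos_iff.1 hpos
        infer_instance
      exact zero_ne_one h
    have hmf : f ∣ minpoly F (A i) := by
      obtain ⟨k, -, hk⟩ := (dvd_prime_pow hf.prime s).1 (minpoly.dvd F (A i) h2)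
      have hk0 : k ≠ 0 := by
        rintro rfl
        rw [pow_zero] at hk
        exact hne (associated_one_iff_isUnit.1 hk)
      exact (dvd_pow_self f hk0).trans hk.symm.dvd
    have hfA : f ∣ (A i).charpoly := hmf.trans (Matrix.minpoly_dvd_charpoly (A i))
    exact (eq_of_monic_of_associated hfm (Matrix.charpoly_monic _)
      (hf.associated_of_dvd (hA i) hfA)).symm
  have hsep : f.Separable := PerfectField.separable_of_irreducible hf
  have hcardi : ∀ i, Nat.card (LinearMap.ker
      (aeval (jordanMap (Matrix.toLin' (A i)) (t i)) f)) = Fintype.card F ^ f.natDegree := by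
    intro i
    have h0 : aeval (Matrix.toLin' (A i)) f = 0 := by
      rw [aeval_toLin', ← hchar i, Matrix.aeval_self_charpoly, map_zero]
    rw [card_ker_aeval_jordanMap hsep h0 (ht i), ← hchar i, Matrix.charpoly_natDegree_eq_dim]
    simp
  have hequiv : Nat.card (LinearMap.ker (aeval g f)) = Nat.card (∀ i, LinearMap.ker
      (aeval (jordanMap (Matrix.toLin' (A i)) (t i)) f)) := by
    refine Nat.card_congr ((Equiv.subtypeEquiv e.toEquiv fun v => ?_).trans Equiv.subtypePiEquivPi)
    rw [LinearMap.mem_ker, ← e.map_eq_zero_iff, funext_iff]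
    exact forall_congr' fun i => by rw [hcomm]; rfl
  rw [hequiv, Nat.card_pi, Finset.prod_congr rfl fun i _ => hcardi i]
  rw [Finset.prod_const, Finset.card_univ, Fintype.card_fin, ← pow_mul, mul_comm]

/-- A matrix with prescribed monic nonconstant characteristic polynomial. -/
theorem exists_charpoly_eq {f : F[X]} (hfm : f.Monic) :
    ∃ (n : ℕ) (A : Matrix (Fin n) (Fin n) F), A.charpoly = f := by
  -- Multiplication by the adjoined root in `F[X] / (f)`.
  refine ⟨_, Algebra.leftMulMatrix (AdjoinRoot.powerBasis' hfm).basis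
    (AdjoinRoot.powerBasis' hfm).gen, ?_⟩
  rw [charpoly_leftMulMatrix, AdjoinRoot.powerBasis'_gen]
  exact AdjoinRoot.minpoly_root hfm.ne_zero |>.trans (by simp [hfm.leadingCoeff])

/-- The structure theorem splits the `F[X]`-module of `g` into pieces `F[X] / (f ^ k)`. By cyclicity
each piece with `k > 0` is the Jordan block of length `k` on one fixed matrix with characteristic
polynomial `f`. -/
theorem exists_hasJordanFormWithBlocks [Finite F] [FiniteDimensional F V] {g : V →ₗ[F] V} {f : F[X]}
    (hf : Irreducible f) (hfm : f.Monic) {s : ℕ} (hs : aeval g (f ^ s) = 0) :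
    ∃ m, HasJordanFormWithBlocks g m := by
  classical
  have hsep : f.Separable := PerfectField.separable_of_irreducible hf
  obtain ⟨n, A, hA⟩ := exists_charpoly_eq hfm
  have hn : n = f.natDegree := by
    rw [← hA, Matrix.charpoly_natDegree_eq_dim, Fintype.card_fin]
  have hA0 : aeval (Matrix.toLin' A) f = 0 := by
    rw [aeval_toLin', ← hA, Matrix.aeval_self_charpoly, map_zero]
  have hnt : Nontrivial (Fin n → F) := by
    have : Nonempty (Fin n) := ⟨⟨0, hn ▸ hf.natDegree_pos⟩⟩
    infer_instance
  have hcyc : ∀ k, 0 < k → Nonempty (Module.AEval' (jordanMap (Matrix.toLin' A) k) ≃ₗ[F[X]]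
      F[X] ⧸ Submodule.span F[X] {f ^ k}) := fun k hk =>
    nonempty_linearEquiv_quotient_span_pow hf hk (aeval_jordanMap_pow_eq_zero hsep hA0 k)
      (aeval_jordanMap_pow_pred_ne_zero hsep hA0 hk) (by simp [Module.finrank_pi_fintype, hn])
  have htors : Module.IsTorsion' (Module.AEval' g) (Submonoid.powers f) := by
    intro x
    refine ⟨⟨f ^ s, s, rfl⟩, ?_⟩
    obtain ⟨x, rfl⟩ := (Module.AEval'.of g).surjective x
    change f ^ s • Module.AEval'.of g x = 0
    rw [← Module.AEval.of_aeval_smul, hs, zero_smul, map_zero]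
  obtain ⟨d, k, ⟨e⟩⟩ := Module.torsion_by_prime_power_decomposition hf htors
  -- The decomposition may contain zero summands with `k i = 0`; they are discarded because blocks
  -- have positive length.
  let I := {i : Fin d // 0 < k i}
  have hsub : ∀ i : Fin d, ¬ 0 < k i → Subsingleton (F[X] ⧸ Submodule.span F[X] {f ^ k i}) := by
    intro i hi
    rw [Submodule.Quotient.subsingleton_iff, Nat.eq_zero_of_not_pos hi, pow_zero]
    exact Ideal.span_singleton_one
  let ε : Fin (Fintype.card I) ≃ I := (Fintype.equivFin I).symm
  let ρ : (∀ i : Fin d, F[X] ⧸ Submodule.span F[X] {f ^ k i}) →ₗ[F[X]]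
      (∀ j, F[X] ⧸ Submodule.span F[X] {f ^ k (ε j).1}) :=
    LinearMap.pi fun j => LinearMap.proj (ε j).1
  have hρ : Function.Bijective ρ := by
    constructor
    · intro x y hxy
      funext i
      by_cases hi : 0 < k i
      · have h := congrFun hxy (ε.symm ⟨i, hi⟩)
        simp only [ρ, LinearMap.pi_apply, LinearMap.proj_apply] at h
        rw [ε.apply_symm_apply] at h
        exact h
      · exact (hsub i hi).elim _ _
    · intro y
      have hx : ∀ i, ∃ x : F[X] ⧸ Submodule.span F[X] {f ^ k i}, ∀ j, (ε j).1 = i → y j ≍ x := by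
        intro i
        by_cases hi : 0 < k i
        · obtain ⟨j, rfl⟩ : ∃ j, (ε j).1 = i := ⟨ε.symm ⟨i, hi⟩, by rw [ε.apply_symm_apply]⟩
          refine ⟨y j, fun j' h => ?_⟩
          obtain rfl := ε.injective (Subtype.ext h)
          rfl
        · exact ⟨0, fun j h => absurd (h ▸ (ε j).2) hi⟩
      choose x hx using hx
      exact ⟨x, funext fun j => (eq_of_heq (hx _ j rfl)).symm⟩
  let E : Module.AEval' g ≃ₗ[F[X]]
      (∀ j, Module.AEval' (jordanMap (Matrix.toLin' A) (k (ε j).1))) :=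
    e.trans ((DirectSum.linearEquivFunOnFintype F[X] (Fin d) _).trans
      ((LinearEquiv.ofBijective ρ hρ).trans
        (LinearEquiv.piCongrRight fun j => (hcyc (k (ε j).1) (ε j).2).some.symm)))
  refine ⟨Fintype.card I, (hasJordanFormWithBlocks_iff g _).2
    ⟨fun _ => n, fun j => k (ε j).1, fun _ => A,
      (Module.AEval'.of g).trans ((E.restrictScalars F).trans
        (LinearEquiv.piCongrRight fun j => (Module.AEval'.of _).symm)), fun j => (ε j).2,
      fun _ => by rw [hA]; exact hf, fun v j => ?_⟩⟩
  simp only [LinearEquiv.trans_apply, LinearEquiv.restrictScalars_apply,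
    LinearEquiv.piCongrRight_apply]
  rw [← Module.AEval'.X_smul_of, map_smul, Pi.smul_apply, Module.AEval'.of_symm_X_smul]

end JordanForm

end PhiMod

/-! ### The main theorem -/

theorem mainTheorem12 (q r : ℕ)
    {F : Type*} [Field F] [Fintype F] (hF : Fintype.card F = q)
    {K : Type*} [Field K] [Fintype K] [Algebra F K] (hK : Fintype.card K = q ^ r)
    {D : Type*} [AddCommGroup D] [Module K D] [FiniteDimensional K D]
    (φ : D →ₛₗ[PhiMod.frob F K] D)
    (hφ : PhiMod.IsEtale φ)
    (hcomp : PhiMod.CompositionFactorsIsomorphic φ) :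
    (∃ m : ℕ, PhiMod.HasJordanFormWithBlocks (PhiMod.frobeniusOnRep F φ) m) ∧
      ∀ m : ℕ, PhiMod.HasJordanFormWithBlocks (PhiMod.frobeniusOnRep F φ) m →
        (PhiMod.HasGenerator φ ↔ m ≤ r) := by
  subst hF
  have hφb : Function.Bijective φ := hφ.bijective
  have hr : ∀ k : K, k ^ Fintype.card F ^ r = k := fun k => by rw [← hK, FiniteField.pow_card]
  obtain ⟨f, hf, hfm, hf0, s, hs⟩ := hcomp.exists_irreducible_pow hr hφb
  have hsV : Polynomial.aeval (PhiMod.frobeniusOnRep F φ) (f ^ s) = 0 := by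
    refine LinearMap.ext fun u => Subtype.ext (LinearMap.ext fun x => ?_)
    rw [PhiMod.aeval_frobeniusOnRep_apply hr hK φ, hs, map_zero]
    rfl
  have hVfin : Finite (PhiMod.assocSpace F φ) := PhiMod.assocSpace_finite hφb
  have hVfd : FiniteDimensional F (PhiMod.assocSpace F φ) := Module.Finite.of_finite
  refine ⟨PhiMod.exists_hasJordanFormWithBlocks (V := PhiMod.assocSpace F φ)
    (g := PhiMod.frobeniusOnRep F φ) (s := s) hf hfm hsV, fun m hm => ?_⟩
  have hcard := PhiMod.HasJordanFormWithBlocks.card_ker (V := PhiMod.assocSpace F φ)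
    (g := PhiMod.frobeniusOnRep F φ) (s := s) hm hf hfm hsV
  have hiff := PhiMod.hasGenerator_iff_card_ker_le hφb hK hf hf0 hsV
  have hcard' : Nat.card (LinearMap.ker (Polynomial.aeval (PhiMod.frobeniusOnRep F φ) f)) =
      Fintype.card F ^ (m * f.natDegree) := hcard
  -- Both kernel sizes are powers of `q`, with exponents `m * deg f` and `r * deg f`.
  rw [hiff, hcard', ← pow_mul, Nat.pow_le_pow_iff_right Fintype.one_lt_card]
  exact Nat.mul_le_mul_right_iff hf.natDegree_pos
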